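/- An index is a finite sequence $\mathbf k=(k_1,\dots,k_r)$ of positive integers; its weight is $k_1+\cdots+k_r$, its depth is $d(\mathbf k)=r$, and $J(\mathbf k)=\{k_1,k_1+k_2,\dots,k_1+\cdots+k_{r-1}\}$. For indices of equal weight, $\mathbf k\succeq\mathbf k'$ ($\mathbf k$ refines $\mathbf k'$) means $J(\mathbf k)\supset J(\mathbf k')$. The Hoffman dual $\mathbf k^\vee$ of an index $\mathbf k$ of weight $n$ is the unique index of weight $n$ with $J(\mathbf k^\vee)=\{1,\dots,n-1\}\setminus J(\mathbf k)$. Put $\mathbf k^\star=\sum_{\mathbf k'\preceq\mathbf k}\mathbf k'$ (a formal sum of indices). The harmonic product $*$ of indices is the formal sum defined by $\varnothing*\mathbf k=\mathbf k*\varnothing=\mathbf k$ and $$(k_1,\dots,k_r)*(l_1,\dots,l_s)=\bigl((k_1,\dots,k_{r-1})*(l_1,\dots,l_s),k_r\bigr)+\bigl((k_1,\dots,k_r)*(l_1,\dots,l_{s-1}),l_s\bigr)+\bigl((k_1,\dots,k_{r-1})*(l_1,\dots,l_{s-1}),k_r+l_s\bigr),$$ and for $r,s>0$ we put $(k_1,\dots,k_r)\circledast(l_1,\dots,l_s)=\bigl((k_1,\dots,k_{r-1})*(l_1,\dots,l_{s-1}),k_r+l_s\bigr)$,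 extended bilinearly. The multiple zeta value $\zeta(\mathbf k)=\sum_{0<n_1<\cdots<n_r}n_1^{-k_1}\cdots n_r^{-k_r}$ (for $k_r>1$) is extended linearly to formal sums. Let $\mathrm{Li}_{\mathbf k}$ be the holomorphic continuation to $\mathbb C\setminus[1,\infty)$ of $\sum_{0<n_1<\cdots<n_r}\frac{z^{n_r}}{n_1^{k_1}\cdots n_r^{k_r}}$ ($|z|<1$), and let $$\eta(\mathbf k;s)=\frac1{\Gamma(s)}\int_0^\infty\frac{\mathrm{Li}_{\mathbf k}(1-e^t)}{1-e^t}\,t^{s-1}\,dt\qquad(\operatorname{Re}s>0)$$ be the Kaneko–Tsumura function. **Theorem.** Let $\mathbf k$ be a nonempty index and $l>0$ an integer. Then $\mathrm{Li}_{\mathbf k}$ exists, the integral defining $\eta(\mathbf k;l)$ converges absolutely, all multiple zeta series occurring below converge, and $$\eta(\mathbf k;l)=(-1)^{d(\mathbf k^\vee)}\sum_{\mathbf k'\succeq\mathbf k^\vee}(-1)^{d(\mathbf k')}\,\zeta\bigl((\mathbf k')^\star\circledast(\underbrace{1,\dots,1}_{l})^\star\bigr).$$ -/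

import Mathlib

/-!
An index of weight `n` is a `Composition n`: a finite sequence of positive integers with sum `n`;
its depth is `Composition.length`.  Formal linear combinations of indices (of arbitrary weight)
are finitely supported functions `List ℕ →₀ ℤ`.
-/

namespace KanekoTsumura

noncomputable section

/-! ### Indices: refinement and Hoffman dual -/

/-- `J(k) = {k₁, k₁ + k₂, …, k₁ + ⋯ + k_{r-1}} ⊆ {1, …, n - 1}`. -/
def J {n : ℕ} (k : Composition n) : Finset ℕ :=
  (Finset.Ico 1 k.length).image k.sizeUpTo

/-- `Refines k k'`: the index `k` is a refinement of the index `k'` (of the same weight),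
written `k ⪰ k'`. -/
def Refines {n : ℕ} (k k' : Composition n) : Prop := J k' ⊆ J k

instance {n : ℕ} (k k' : Composition n) : Decidable (Refines k k') :=
  inferInstanceAs (Decidable (J k' ⊆ J k))

/-- The Hoffman dual of `k`.  Here `boundaries` is the set of all partial sums, including `0`
and `n`; see `J_hoffmanDual` and `eq_of_J_eq` for the characterization through `J`. -/
def hoffmanDual {n : ℕ} (k : Composition n) : Composition n :=
  CompositionAsSet.toComposition
    { boundaries := Finset.univ.filter fun i => i = 0 ∨ i = Fin.last n ∨ i ∉ k.boundaries
      zero_mem := by simp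
      getLast_mem := by simp }

theorem mem_J_iff {n : ℕ} (k : Composition n) (m : ℕ) :
    m ∈ J k ↔ 0 < m ∧ ∃ h : m < n, (⟨m, by omega⟩ : Fin (n + 1)) ∈ k.boundaries := by
  have key : ∀ i j : ℕ, i < j → j ≤ k.length → k.sizeUpTo i < k.sizeUpTo j := by
    intro i j hij hj
    have h1 : k.sizeUpTo i < k.sizeUpTo (i + 1) := k.sizeUpTo_strict_mono (by omega)
    exact lt_of_lt_of_le h1 (k.monotone_sizeUpTo hij)
  simp only [J, Finset.mem_image, Finset.mem_Ico, Composition.boundaries, Finset.mem_map,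
    Finset.mem_univ, true_and, Composition.boundary]
  constructor
  · rintro ⟨i, ⟨h1, h2⟩, rfl⟩
    have h3 := key 0 i (by omega) (by omega)
    have h4 := key i k.length h2 le_rfl
    rw [k.sizeUpTo_length] at h4
    exact ⟨by omega, h4, ⟨i, by omega⟩, by simp⟩
  · rintro ⟨h0, hn, i, hi⟩
    have hi' : k.sizeUpTo i = m := by simpa [Fin.ext_iff] using hi
    refine ⟨i, ⟨?_, ?_⟩, hi'⟩
    · rcases Nat.eq_zero_or_pos (i : ℕ) with h | h
      · rw [h, k.sizeUpTo_zero] at hi'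
        omega
      · exact h
    · by_contra hlt
      have : (i : ℕ) = k.length := by omega
      rw [this, k.sizeUpTo_length] at hi'
      omega

/-- `J(k^∨) = {1, …, n - 1} ∖ J(k)`. -/
theorem J_hoffmanDual {n : ℕ} (k : Composition n) :
    J (hoffmanDual k) = Finset.Ico 1 n \ J k := by
  ext m
  rw [Finset.mem_sdiff, mem_J_iff, mem_J_iff]
  simp only [hoffmanDual, CompositionAsSet.toComposition_boundaries, Finset.mem_filter,
    Finset.mem_univ, true_and, Finset.mem_Ico, Fin.ext_iff, Fin.val_zero, Fin.val_last]
  constructor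
  · rintro ⟨h0, hn, h | h | h⟩
    · omega
    · omega
    · exact ⟨⟨h0, hn⟩, fun ⟨_, _, h'⟩ => h h'⟩
  · rintro ⟨⟨h0, hn⟩, h⟩
    exact ⟨h0, hn, Or.inr (Or.inr fun h' => h ⟨h0, hn, h'⟩)⟩

/-- An index of given weight is determined by `J`. -/
theorem eq_of_J_eq {n : ℕ} {k k' : Composition n} (h : J k = J k') : k = k' := by
  apply (compositionEquiv n).injective
  apply CompositionAsSet.ext
  change k.boundaries = k'.boundaries
  ext ⟨m, hm⟩
  rcases Nat.eq_zero_or_pos m with rfl | h0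
  · exact iff_of_true k.toCompositionAsSet.zero_mem k'.toCompositionAsSet.zero_mem
  · rcases Nat.lt_or_ge m n with hn | hn
    · have := mem_J_iff k m
      have h' := mem_J_iff k' m
      rw [← h, this] at h'
      simpa [h0, hn] using h'
    · obtain rfl : m = n := by omega
      exact iff_of_true k.toCompositionAsSet.getLast_mem k'.toCompositionAsSet.getLast_mem

/-! ### Formal sums of indices -/

/-- `k^⋆`, the formal sum of all indices of which `k` is a refinement. -/
def starSum {n : ℕ} (k : Composition n) : List ℕ →₀ ℤ :=
  ∑ k' : Composition n with Refines k k', Finsupp.single k'.blocks 1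

/-- The harmonic product for reversed sequences, the head of a list being its last entry. -/
def harmonicRev : List ℕ → List ℕ → (List ℕ →₀ ℤ)
  | [], l => Finsupp.single l 1
  | a :: k, [] => Finsupp.single (a :: k) 1
  | a :: k, b :: l =>
      (harmonicRev k (b :: l)).mapDomain (a :: ·) +
      (harmonicRev (a :: k) l).mapDomain (b :: ·) +
      (harmonicRev k l).mapDomain ((a + b) :: ·)
  termination_by k l => k.length + l.length

/-- The harmonic product `k * l`. -/
def harmonic (k l : List ℕ) : List ℕ →₀ ℤ :=
  (harmonicRev k.reverse l.reverse).mapDomain List.reverse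

theorem harmonic_nil_left (l : List ℕ) : harmonic [] l = Finsupp.single l 1 := by
  simp [harmonic, harmonicRev, Finsupp.mapDomain_single]

theorem harmonic_nil_right (k : List ℕ) : harmonic k [] = Finsupp.single k 1 := by
  unfold harmonic
  rcases h : k.reverse with _ | ⟨a, k'⟩
  · simp_all [harmonicRev, Finsupp.mapDomain_single]
  · simp only [List.reverse_nil, harmonicRev, Finsupp.mapDomain_single]
    rw [← h, List.reverse_reverse]

theorem harmonic_snoc (k l : List ℕ) (a b : ℕ) :
    harmonic (k ++ [a]) (l ++ [b]) =
      (harmonic k (l ++ [b])).mapDomain (· ++ [a]) +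
      (harmonic (k ++ [a]) l).mapDomain (· ++ [b]) +
      (harmonic k l).mapDomain (· ++ [a + b]) := by
  simp only [harmonic, List.reverse_append, List.reverse_cons, List.reverse_nil, List.nil_append,
    List.singleton_append, harmonicRev, Finsupp.mapDomain_add, ← Finsupp.mapDomain_comp]
  have h : ∀ c : ℕ, (List.reverse ∘ fun m : List ℕ => c :: m) =
      (fun m : List ℕ => m ++ [c]) ∘ List.reverse := by
    intro c
    ext1 m
    simp
  rw [h, h, h]

/-- `k ⊛ l = ((k₁, …, k_{r-1}) * (l₁, …, l_{s-1}), k_r + l_s)`; only meant for nonempty `k`, `l`. -/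
def circ (k l : List ℕ) : List ℕ →₀ ℤ :=
  (harmonic k.dropLast l.dropLast).mapDomain (· ++ [k.getLastD 0 + l.getLastD 0])

/-- The bilinear extension of `⊛`. -/
def circLin (α β : List ℕ →₀ ℤ) : List ℕ →₀ ℤ :=
  α.sum fun k a => β.sum fun l b => (a * b) • circ k l

/-! ### Multiple zeta values -/

/-- The sequences `0 < n₁ < ⋯ < n_r` of integers. -/
abbrev IncTuple (r : ℕ) : Type := {n : Fin r → ℕ // StrictMono n ∧ ∀ i, 0 < n i}

/-- The summand `1 / (n₁^{k₁} ⋯ n_r^{k_r})`. -/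
def mzvTerm (k : List ℕ) (n : IncTuple k.length) : ℝ :=
  1 / ∏ i, (n.1 i : ℝ) ^ k.get i

/-- The multiple zeta value `ζ(k)`. -/
def mzv (k : List ℕ) : ℝ := ∑' n : IncTuple k.length, mzvTerm k n

/-- The linear extension of `ζ` to formal sums. -/
def mzvLin (α : List ℕ →₀ ℤ) : ℝ := α.sum fun k a => (a : ℝ) * mzv k

/-! ### Multiple polylogarithms and the Kaneko-Tsumura function -/

/-- The last entry `n_r` of a sequence (`0` for the empty sequence). -/
def lastEntry {r : ℕ} (n : Fin r → ℕ) : ℕ := if h : 0 < r then n ⟨r - 1, by omega⟩ else 0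

/-- The summand `z^{n_r} / (n₁^{k₁} ⋯ n_r^{k_r})`. -/
def polylogTerm (k : List ℕ) (z : ℂ) (n : IncTuple k.length) : ℂ :=
  z ^ lastEntry n.1 / ∏ i, (n.1 i : ℂ) ^ k.get i

/-- `F` is (on `ℂ ∖ [1, ∞)`) the multiple polylogarithm `Li_k`: it is holomorphic on
`ℂ ∖ [1, ∞)`, and given on the open unit disc by the defining multiple series. -/
def IsPolylog (k : List ℕ) (F : ℂ → ℂ) : Prop :=
  DifferentiableOn ℂ F {z | 1 - z ∈ Complex.slitPlane} ∧
    ∀ z : ℂ, ‖z‖ < 1 → HasSum (polylogTerm k z) (F z)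

/-- The multiple polylogarithm `Li_k` on `ℂ ∖ [1, ∞)`, the holomorphic continuation of the multiple
series.  By the identity theorem its values there are determined by `IsPolylog`. -/
def polylog (k : List ℕ) : ℂ → ℂ := Classical.epsilon (IsPolylog k)

/-- The integrand `Li_k(1 - e^t) / (1 - e^t) · t^{s-1}`. -/
def etaIntegrand (k : List ℕ) (s : ℂ) (t : ℝ) : ℂ :=
  polylog k (1 - Complex.exp t) / (1 - Complex.exp t) * (t : ℂ) ^ (s - 1)

/-- The Kaneko-Tsumura function `η(k; s)`, by its integral representation (for positive `k_j` the
integral converges for `Re s > 0`). -/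
def eta (k : List ℕ) (s : ℂ) : ℂ :=
  1 / Complex.Gamma s * ∫ t in Set.Ioi (0 : ℝ), etaIntegrand k s t

end

end KanekoTsumura

/-!
The identity comes from expanding both sides as `∑ a(N) b(N)` over the largest summation variable
`N`, where `b` is the same on both sides.

*Coefficients.*  An index of weight `j + 1` is the same as the set `A = J(k) ⊆ {1, …, j}`.  Adding
one unit of weight divides the coefficient sequence of `Li_k` by `N`, preceded by the summation over
`m < N` when a new entry is started, that is, at a position of `A`; this is the recursion defining
`coeff`.  Summing over all refinements of `k` replaces the steps outside `A` by the summation over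
`m ≤ N` followed by division by `N`; this is `refineCoeff` (`sum_coeff_eq_refineCoeff`).  For
`A = ∅` one gets the star sum of `(1, …, 1)`.

*The left side.*  `Li_k` is continued by integrating against `dz / z` and `dz / (1 - z)`.  Landen's
formula (`exists_continuation`) gives, for `z < 0`,
`Li_k(z) = (-1)^{d(k)} ∑_{k' ⪰ k} Li_{k'}(z / (z - 1))`,
since in the variable `w = z / (z - 1)` the form `dz / z` becomes `dw / w + dw / (1 - w)`, and
`dz / (1 - z)` becomes `-dw / (1 - w)`.  At `z = 1 - e^t` one has `w = 1 - e^{-t}`, and termwise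
integration with `∫ (1 - e^{-t})^{N-1} e^{-t} t^{l-1} dt = (l - 1)! · refineCoeff ∅ (l - 1) N`
(`integral_kernel`) expresses `η(k; l)` through
`∑ refineCoeff (J k) (n - 1) N * refineCoeff ∅ (l - 1) N` (`integral_landen`).

*The right side.*  Splitting a multiple zeta series by its largest variable (`hasSum_mzvTerm`), the
harmonic product becomes the product of truncated sums (`truncated_mul`), so `⊛` multiplies the sums
with prescribed largest variable (`ev_circ`, `mzvLin_circ`).  The alternating sum over refinements
of the dual then collapses, by the vanishing of alternating sums over intervals of sets, to the sum
over the refinements of `k` itself (`sum_refine_dual`).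

All sequences that occur are `O(N^{-3/4})` (`Decay`), which gives every convergence needed.
-/

namespace KanekoTsumura

open Complex Set Filter Topology

/-! ### Holomorphic functions on the slit plane -/

/-- The domain `ℂ ∖ [1, ∞)`. -/
def slitDomain : Set ℂ := {z | 1 - z ∈ slitPlane}

theorem isOpen_slitDomain : IsOpen slitDomain :=
  isOpen_slitPlane.preimage (by fun_prop)

theorem zero_mem_slitDomain : (0 : ℂ) ∈ slitDomain := by simp [slitDomain]

theorem one_sub_ne_zero_of_mem_slitDomain {z : ℂ} (hz : z ∈ slitDomain) : 1 - z ≠ 0 :=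
  slitPlane_ne_zero hz

theorem starConvex_slitDomain : StarConvex ℝ 0 slitDomain := by
  intro z hz a b ha hb hab
  have h := starConvex_one_slitPlane hz ha hb hab
  have e : a • (1 : ℂ) + b • (1 - z) = 1 - (a • 0 + b • z) := by
    have : (a : ℂ) + b = 1 := by exact_mod_cast hab
    simp only [real_smul, mul_zero, zero_add]
    linear_combination this
  rwa [e] at h

theorem mem_slitDomain_of_norm_lt_one {z : ℂ} (hz : ‖z‖ < 1) : z ∈ slitDomain := by
  refine Or.inl ?_
  have := (abs_re_le_norm z).trans_lt hz
  rw [abs_lt] at this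
  simp only [sub_re, one_re]
  linarith

/-- A holomorphic function on `ℂ ∖ [1, ∞)` has a primitive: in the coordinate `log (1 - z)` the
domain is a strip, which is convex. -/
theorem exists_primitive {f : ℂ → ℂ} (hf : DifferentiableOn ℂ f slitDomain) :
    ∃ G : ℂ → ℂ, G 0 = 0 ∧ ∀ z ∈ slitDomain, HasDerivAt G (f z) z := by
  set T : Set ℂ := {u | u.im ∈ Ioo (-Real.pi) Real.pi} with hT
  have hTo : IsOpen T := isOpen_Ioo.preimage continuous_im
  have hTc : Convex ℝ T := (convex_Ioo _ _).is_linear_preimage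
    (f := im) ⟨fun _ _ => by simp, fun _ _ => by simp⟩
  have hexp : ∀ u ∈ T, 1 - exp u ∈ slitDomain := by
    intro u hu
    change 1 - (1 - exp u) ∈ slitPlane
    rw [sub_sub_cancel, mem_slitPlane_iff_arg]
    refine ⟨?_, exp_ne_zero u⟩
    rw [← log_im, log_exp hu.1 hu.2.le]
    exact hu.2.ne
  set h : ℂ → ℂ := fun u => -f (1 - exp u) * exp u
  have hd : DifferentiableOn ℂ h T := by
    have h1 : DifferentiableOn ℂ (fun u => f (1 - exp u)) T :=
      hf.comp (by fun_prop) hexp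
    exact h1.neg.mul (by fun_prop)
  obtain ⟨H, hH⟩ := hTc.exists_forall_hasDerivWithinAt hd
  have hH' : ∀ u ∈ T, HasDerivAt H (h u) u := fun u hu => (hH u hu).hasDerivAt (hTo.mem_nhds hu)
  refine ⟨fun z => H (log (1 - z)) - H (log (1 - 0)), by simp, fun z hz => ?_⟩
  have hl : log (1 - z) ∈ T := by
    have := mem_slitPlane_iff_arg.1 hz
    simp only [hT, mem_ofPred_eq, log_im]
    exact ⟨neg_pi_lt_arg _, lt_of_le_of_ne (arg_le_pi _) this.1⟩
  have h1 : HasDerivAt (fun z : ℂ => log (1 - z)) (-1 / (1 - z)) z :=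
    ((hasDerivAt_id z).const_sub 1).clog hz
  have h2 := ((hH' _ hl).comp z h1).sub_const (H (log (1 - 0)))
  refine h2.congr_deriv ?_
  have hne := one_sub_ne_zero_of_mem_slitDomain hz
  change -f (1 - exp (log (1 - z))) * exp (log (1 - z)) * (-1 / (1 - z)) = f z
  rw [exp_log hne, sub_sub_cancel]
  field_simp

/-- A function with vanishing derivative along a segment, except possibly at its end point `0`,
takes the same value at both ends. -/
theorem eq_of_hasDerivAt_zero_on_segment {H : ℂ → ℂ} {z : ℂ} (h0 : ContinuousAt H 0)
    (hd : ∀ t : ℝ, 0 < t → t ≤ 1 → HasDerivAt H 0 (t * z)) : H z = H 0 := by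
  have := constant_of_has_deriv_right_zero (f := fun t : ℝ => H (((1 - t : ℝ) : ℂ) * z))
    (a := 0) (b := 1) ?_ ?_ 1 (by simp)
  · simpa using this.symm
  · intro t ht
    have hlin : ContinuousAt (fun t : ℝ => (((1 - t : ℝ) : ℂ) * z)) t := by fun_prop
    refine ContinuousAt.continuousWithinAt ?_
    rcases ht.2.eq_or_lt with rfl | hlt
    · exact ContinuousAt.comp (f := fun t : ℝ => (((1 - t : ℝ) : ℂ) * z)) (by simpa using h0) hlin
    · exact ContinuousAt.comp (f := fun t : ℝ => (((1 - t : ℝ) : ℂ) * z))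
        (hd (1 - t) (by linarith) (by linarith [ht.1])).continuousAt hlin
  · intro t ht
    have h1 := hd (1 - t) (by linarith [ht.2]) (by linarith [ht.1])
    have h2 : HasDerivAt (fun t : ℝ => (((1 - t : ℝ) : ℂ) * z)) (-z) t := by
      have := (((hasDerivAt_id t).const_sub 1).ofReal_comp).mul_const z
      simpa using this
    have := HasDerivAt.comp (h := fun t : ℝ => (((1 - t : ℝ) : ℂ) * z)) t h1 h2
    simpa [Function.comp_def] using this.hasDerivWithinAt

/-! ### Power series with bounded coefficients -/

/-- The power series with coefficients `f`. -/
noncomputable def genFun (f : ℕ → ℝ) (z : ℂ) : ℂ := ∑' N, (f N : ℂ) * z ^ N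

theorem summable_genFun {f : ℕ → ℝ} {C : ℝ} (hf : ∀ N, |f N| ≤ C) {z : ℂ} (hz : ‖z‖ < 1) :
    Summable fun N => (f N : ℂ) * z ^ N := by
  refine Summable.of_norm_bounded (g := fun N => C * ‖z‖ ^ N)
    ((summable_geometric_of_lt_one (norm_nonneg z) hz).mul_left C) fun N => ?_
  rw [norm_mul, norm_pow, norm_real, Real.norm_eq_abs]
  gcongr
  exact hf N

theorem genFun_zero {f : ℕ → ℝ} (hf : f 0 = 0) : genFun f 0 = 0 := by
  unfold genFun
  refine (tsum_congr fun N => ?_).trans tsum_zero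
  rcases N with _ | N
  · simp [hf]
  · simp

/-- The derivative of a power series, with `z` times the derivative written without shift. -/
theorem hasDerivAt_genFun {f : ℕ → ℝ} {C : ℝ} (hf : ∀ N, |f N| ≤ C) {z : ℂ} (hz : ‖z‖ < 1) :
    ∃ D, HasDerivAt (genFun f) D z ∧ D * z = ∑' N, ((N * f N : ℝ) : ℂ) * z ^ N := by
  obtain ⟨r, hr1, hr2⟩ := exists_between hz
  have hr0 : 0 < r := (norm_nonneg z).trans_lt hr1
  have hu : Summable fun N : ℕ => C * (N * r ^ (N - 1)) := by
    refine Summable.mul_left C ?_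
    have h1 : Summable fun N : ℕ => ((N : ℝ) ^ 1 * r ^ N : ℝ) :=
      summable_pow_mul_geometric_of_norm_lt_one 1 (by rwa [Real.norm_eq_abs, abs_of_pos hr0])
    refine (h1.mul_left r⁻¹).congr fun N => ?_
    rcases N with _ | N
    · simp
    · simp only [Nat.add_sub_cancel, pow_succ]
      field_simp
  have key := hasDerivAt_tsum_of_isPreconnected (𝕜 := ℂ) (F := ℂ) (t := Metric.ball 0 r)
    (g := fun N z => (f N : ℂ) * z ^ N) (g' := fun N z => (f N : ℂ) * (N * z ^ (N - 1)))
    (y₀ := 0) (y := z) hu Metric.isOpen_ball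
    (convex_ball _ _).isPreconnected
    (fun N y _ => (hasDerivAt_pow N y).const_mul _)
    (by
      intro N y hy
      have hy' : ‖y‖ ≤ r := (mem_ball_zero_iff.1 hy).le
      rw [norm_mul, norm_mul, norm_pow, norm_real, Real.norm_eq_abs, norm_natCast]
      have hC : 0 ≤ C := (abs_nonneg _).trans (hf N)
      gcongr
      exact hf N) (by simpa using hr0)
    (summable_genFun hf (by simp)) (by simpa using hr1)
  refine ⟨_, key, ?_⟩
  rw [← tsum_mul_right]
  refine tsum_congr fun N => ?_
  rcases N with _ | N
  · simp
  · simp only [Nat.add_sub_cancel, pow_succ]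
    push_cast
    ring

theorem differentiableAt_genFun {f : ℕ → ℝ} {C : ℝ} (hf : ∀ N, |f N| ≤ C) {z : ℂ}
    (hz : ‖z‖ < 1) : DifferentiableAt ℂ (genFun f) z :=
  let ⟨_, h, _⟩ := hasDerivAt_genFun hf hz
  h.differentiableAt

/-- `(1 - z) ∑ (∑_{m < N} f m) z^N = z ∑ f N z^N`. -/
theorem one_sub_mul_tsum_partialSum {f F : ℕ → ℝ} (h0 : F 0 = 0)
    (hF : ∀ N, F (N + 1) = F N + f N) {C : ℝ} (hf : ∀ N, |f N| ≤ C) {z : ℂ} (hz : ‖z‖ < 1) :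
    (1 - z) * ∑' N, (F N : ℂ) * z ^ N = z * genFun f z := by
  have hb : ∀ N, |F N| ≤ C * N := by
    intro N
    induction N with
    | zero => simp [h0]
    | succ N ih =>
      rw [hF]
      push_cast
      have := abs_add_le (F N) (f N)
      linarith [hf N]
  have hs : Summable fun N => (F N : ℂ) * z ^ N := by
    have h1 : Summable fun N : ℕ => ((N : ℝ) ^ 1 * ‖z‖ ^ N : ℝ) :=
      summable_pow_mul_geometric_of_norm_lt_one 1 (by rwa [norm_norm])
    refine Summable.of_norm_bounded (h1.mul_left C) fun N => ?_
    rw [norm_mul, norm_pow, norm_real, Real.norm_eq_abs, pow_one, ← mul_assoc]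
    gcongr
    exact hb N
  have h1 : ∑' N, (F N : ℂ) * z ^ N = ∑' N, (F (N + 1) : ℂ) * z ^ (N + 1) := by
    rw [hs.tsum_eq_zero_add]
    simp [h0]
  have h2 : ∑' N, (F (N + 1) : ℂ) * z ^ (N + 1) =
      z * ∑' N, (F N : ℂ) * z ^ N + z * genFun f z := by
    rw [genFun, ← tsum_mul_left, ← tsum_mul_left,
      ← (hs.mul_left z).tsum_add ((summable_genFun hf hz).mul_left z)]
    refine tsum_congr fun N => ?_
    rw [hF]
    push_cast
    ring
  rw [sub_mul, one_mul, sub_eq_iff_eq_add]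
  conv_lhs => rw [h1, h2]
  ring

end KanekoTsumura

namespace KanekoTsumura

open Complex Set Filter Topology

/-! ### Sequences of order `N ^ (-3/4)` -/

/-- Sequences bounded by a multiple of `N ^ (-3/4)`.  The exponent is a convenient one: the class is
stable under `f ↦ (∑_{m ≤ N} f m) / N`, and products of two such sequences are summable.
At `N = 0` the bound says `f 0 = 0`, as `0 ^ (-3/4) = 0`. -/
def Decay (f : ℕ → ℝ) : Prop := ∃ C : ℝ, ∀ N : ℕ, |f N| ≤ C * (N : ℝ) ^ (-(3 / 4) : ℝ)

theorem Decay.zero {f : ℕ → ℝ} (hf : Decay f) : f 0 = 0 := by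
  obtain ⟨C, hC⟩ := hf
  have := hC 0
  rw [Nat.cast_zero, Real.zero_rpow (by norm_num), mul_zero] at this
  exact abs_nonpos_iff.1 this

theorem rpow_neg_le_one (N : ℕ) : (N : ℝ) ^ (-(3 / 4) : ℝ) ≤ 1 := by
  rcases Nat.eq_zero_or_pos N with rfl | h
  · rw [Nat.cast_zero, Real.zero_rpow (by norm_num)]
    exact zero_le_one
  · exact Real.rpow_le_one_of_one_le_of_nonpos (by exact_mod_cast h) (by norm_num)

theorem Decay.bounded {f : ℕ → ℝ} (hf : Decay f) : ∃ C, ∀ N, |f N| ≤ C := by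
  obtain ⟨C, hC⟩ := hf
  have hC0 : 0 ≤ C := by simpa using (abs_nonneg _).trans (hC 1)
  exact ⟨C, fun N => (hC N).trans (mul_le_of_le_one_right hC0 (rpow_neg_le_one N))⟩

theorem Decay.summable_mul {f g : ℕ → ℝ} (hf : Decay f) (hg : Decay g) :
    Summable fun N => f N * g N := by
  obtain ⟨C, hC⟩ := hf
  obtain ⟨D, hD⟩ := hg
  have hs : Summable fun N : ℕ => (N : ℝ) ^ (-(3 / 2) : ℝ) :=
    Real.summable_nat_rpow.2 (by norm_num)
  refine Summable.of_norm_bounded (hs.mul_left (C * D)) fun N => ?_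
  rw [Real.norm_eq_abs, abs_mul]
  have h1 := mul_le_mul (hC N) (hD N) (abs_nonneg _) ((abs_nonneg _).trans (hC N))
  refine h1.trans (le_of_eq ?_)
  rcases Nat.eq_zero_or_pos N with rfl | h
  · rw [Nat.cast_zero, Real.zero_rpow (by norm_num), Real.zero_rpow (by norm_num)]
    ring
  · rw [mul_mul_mul_comm, ← Real.rpow_add (by exact_mod_cast h)]
    norm_num

theorem sum_rpow_neg_le (N : ℕ) :
    ∑ m ∈ Finset.range (N + 1), (m : ℝ) ^ (-(3 / 4) : ℝ) ≤ 4 * (N : ℝ) ^ (1 / 4 : ℝ) := by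
  induction N with
  | zero =>
    rw [Finset.sum_range_one, Nat.cast_zero, Real.zero_rpow (by norm_num),
      Real.zero_rpow (by norm_num), mul_zero]
  | succ N ih =>
    rw [Finset.sum_range_succ]
    have h1 : (0 : ℝ) < ((N + 1 : ℕ) : ℝ) := by positivity
    set x := ((N + 1 : ℕ) : ℝ) ^ (1 / 4 : ℝ) with hx
    set y := (N : ℝ) ^ (1 / 4 : ℝ) with hy
    have hx0 : 0 < x := Real.rpow_pos_of_pos h1 _
    have hy0 : 0 ≤ y := by positivity
    have hx4 : x ^ 4 = N + 1 := by
      rw [hx, ← Real.rpow_natCast, ← Real.rpow_mul h1.le]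
      norm_num
    have hy4 : y ^ 4 = N := by
      rw [hy, ← Real.rpow_natCast, ← Real.rpow_mul (Nat.cast_nonneg N)]
      norm_num
    have e : ((N + 1 : ℕ) : ℝ) ^ (-(3 / 4) : ℝ) = (x ^ 3)⁻¹ := by
      rw [hx, ← Real.rpow_natCast, ← Real.rpow_mul h1.le, ← Real.rpow_neg h1.le]
      norm_num
    have hyx : y ≤ x := Real.rpow_le_rpow (Nat.cast_nonneg N) (by push_cast; linarith) (by norm_num)
    -- `x ^ 4 - y ^ 4 = 1`, and the cofactor of `x - y` is at most `4 x ^ 3`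
    have key : (x ^ 3)⁻¹ ≤ 4 * (x - y) := by
      rw [inv_le_iff_one_le_mul₀ (by positivity)]
      have h2 : (x - y) * (x ^ 3 + x ^ 2 * y + x * y ^ 2 + y ^ 3) = 1 := by
        linear_combination hx4 - hy4
      have h3 : x ^ 3 + x ^ 2 * y + x * y ^ 2 + y ^ 3 ≤ 4 * x ^ 3 := by
        have a1 : x ^ 2 * y ≤ x ^ 2 * x := by gcongr
        have a2 : x * y ^ 2 ≤ x * x ^ 2 := by gcongr
        have a3 : y ^ 3 ≤ x ^ 3 := by gcongr
        nlinarith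
      nlinarith [mul_le_mul_of_nonneg_left h3 (sub_nonneg.2 hyx)]
    rw [e]
    linarith

theorem Decay.of_le_sum {f F : ℕ → ℝ} (hf : Decay f)
    (hF : ∀ N, |F N| ≤ ∑ m ∈ Finset.range (N + 1), |f m|) : Decay fun N => F N / N := by
  obtain ⟨C, hC⟩ := hf
  have hC0 : 0 ≤ C := by simpa using (abs_nonneg _).trans (hC 1)
  refine ⟨4 * C, fun N => ?_⟩
  rcases Nat.eq_zero_or_pos N with rfl | h
  · rw [Nat.cast_zero, Real.zero_rpow (by norm_num)]
    simp
  have h' : (0 : ℝ) < N := by exact_mod_cast h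
  have h1 : |F N| ≤ C * (4 * (N : ℝ) ^ (1 / 4 : ℝ)) := by
    refine (hF N).trans ((Finset.sum_le_sum fun m _ => hC m).trans ?_)
    rw [← Finset.mul_sum]
    exact mul_le_mul_of_nonneg_left (sum_rpow_neg_le N) hC0
  simp only
  rw [abs_div, abs_of_pos h', div_le_iff₀ h']
  refine h1.trans (le_of_eq ?_)
  have : (N : ℝ) ^ (1 / 4 : ℝ) = (N : ℝ) ^ (-(3 / 4) : ℝ) * N := by
    nth_rewrite 3 [← Real.rpow_one (N : ℝ)]
    rw [← Real.rpow_add h']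
    norm_num
  rw [this]
  ring

theorem Decay.sum_div {f : ℕ → ℝ} (hf : Decay f) :
    Decay fun N => (∑ m ∈ Finset.range N, f m) / N :=
  hf.of_le_sum fun N => (Finset.abs_sum_le_sum_abs _ _).trans
    (Finset.sum_le_sum_of_subset_of_nonneg (Finset.range_subset_range.2 N.le_succ)
      fun _ _ _ => abs_nonneg _)

theorem Decay.sum_succ_div {f : ℕ → ℝ} (hf : Decay f) :
    Decay fun N => (∑ m ∈ Finset.range (N + 1), f m) / N :=
  hf.of_le_sum fun _ => Finset.abs_sum_le_sum_abs _ _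

theorem Decay.div {f : ℕ → ℝ} (hf : Decay f) : Decay fun N => f N / N :=
  hf.of_le_sum fun N => Finset.single_le_sum (f := fun m => |f m|) (fun _ _ => abs_nonneg _)
    (Finset.self_mem_range_succ N)

theorem decay_one_div : Decay fun N : ℕ => 1 / (N : ℝ) := by
  refine ⟨1, fun N => ?_⟩
  rcases Nat.eq_zero_or_pos N with rfl | h
  · rw [Nat.cast_zero, Real.zero_rpow (by norm_num)]
    simp
  simp only
  rw [abs_of_nonneg (by positivity), one_div, one_mul, ← Real.rpow_neg_one]
  exact Real.rpow_le_rpow_of_exponent_le (by exact_mod_cast h) (by norm_num)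

/-! ### Coefficient sequences attached to sets of positions -/

/-- The coefficient of `z ^ N` in `Li_k` for the index `k` of weight `j + 1` with
`J(k) = A ∩ {1, …, j}`, built up one unit of weight at a time. -/
noncomputable def coeff (A : Finset ℕ) : ℕ → ℕ → ℝ
  | 0, N => 1 / N
  | j + 1, N => (if j + 1 ∈ A then ∑ m ∈ Finset.range N, coeff A j m else coeff A j N) / N

/-- The sum of `coeff B j` over all `B` with `A ∩ {1, …, j} ⊆ B ⊆ {1, …, j}`, that is, over all
refinements of the index of `A`; see `sum_coeff_eq_refineCoeff`. -/
noncomputable def refineCoeff (A : Finset ℕ) : ℕ → ℕ → ℝ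
  | 0, N => 1 / N
  | j + 1, N => (if j + 1 ∈ A then ∑ m ∈ Finset.range N, refineCoeff A j m
      else ∑ m ∈ Finset.range (N + 1), refineCoeff A j m) / N

theorem decay_coeff (A : Finset ℕ) (j : ℕ) : Decay (coeff A j) := by
  induction j with
  | zero => exact decay_one_div
  | succ j ih =>
    by_cases h : j + 1 ∈ A
    · simpa [coeff, h, funext_iff] using ih.sum_div
    · simpa [coeff, h] using ih.div

theorem decay_refineCoeff (A : Finset ℕ) (j : ℕ) : Decay (refineCoeff A j) := by
  induction j with
  | zero => exact decay_one_div
  | succ j ih =>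
    by_cases h : j + 1 ∈ A
    · simpa [refineCoeff, h] using ih.sum_div
    · simpa [refineCoeff, h] using ih.sum_succ_div

theorem refineCoeff_nonneg (A : Finset ℕ) (j N : ℕ) : 0 ≤ refineCoeff A j N := by
  induction j generalizing N with
  | zero => exact one_div_nonneg.2 N.cast_nonneg
  | succ j ih =>
    simp only [refineCoeff]
    refine div_nonneg ?_ N.cast_nonneg
    split_ifs <;> exact Finset.sum_nonneg fun m _ => ih m

end KanekoTsumura

namespace KanekoTsumura

open Complex Set Filter Topology

/-! ### Continuation and Landen's formula -/

theorem hasDerivAt_genFun_sum {f : ℕ → ℝ} (hf : Decay f) {z : ℂ} (hz : ‖z‖ < 1) :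
    ∃ D, HasDerivAt (genFun fun N => (∑ m ∈ Finset.range N, f m) / N) D z ∧
      (1 - z) * (D * z) = z * genFun f z := by
  obtain ⟨C, hC⟩ := hf.bounded
  obtain ⟨C', hC'⟩ := hf.sum_div.bounded
  obtain ⟨D, hD, hDz⟩ := hasDerivAt_genFun hC' hz
  refine ⟨D, hD, ?_⟩
  rw [hDz, ← one_sub_mul_tsum_partialSum (F := fun N => ∑ m ∈ Finset.range N, f m) (by simp)
    (fun N => Finset.sum_range_succ _ _) hC hz]
  congr 1
  refine tsum_congr fun N => ?_
  rcases N with _ | N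
  · simp
  · rw [mul_div_cancel₀ _ (Nat.cast_ne_zero.2 N.succ_ne_zero)]

theorem hasDerivAt_genFun_sum_succ {f : ℕ → ℝ} (hf : Decay f) {z : ℂ} (hz : ‖z‖ < 1) :
    ∃ D, HasDerivAt (genFun fun N => (∑ m ∈ Finset.range (N + 1), f m) / N) D z ∧
      (1 - z) * (D * z) = genFun f z := by
  obtain ⟨C, hC⟩ := hf.bounded
  obtain ⟨C', hC'⟩ := hf.sum_succ_div.bounded
  obtain ⟨D, hD, hDz⟩ := hasDerivAt_genFun hC' hz
  refine ⟨D, hD, ?_⟩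
  have hshift : genFun f z = z * genFun (fun N => f (N + 1)) z := by
    rw [genFun, (summable_genFun hC hz).tsum_eq_zero_add, genFun, ← tsum_mul_left]
    simp only [hf.zero, ofReal_zero, zero_mul, zero_add]
    refine tsum_congr fun N => ?_
    ring
  rw [hDz, hshift, ← one_sub_mul_tsum_partialSum
    (F := fun N => ∑ m ∈ Finset.range (N + 1), f m) (by simp [hf.zero])
    (fun N => Finset.sum_range_succ _ _) (fun N => hC (N + 1)) hz]
  congr 1
  refine tsum_congr fun N => ?_
  rcases N with _ | N
  · simp [hf.zero]
  · rw [mul_div_cancel₀ _ (Nat.cast_ne_zero.2 N.succ_ne_zero)]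

theorem hasDerivAt_genFun_div {f : ℕ → ℝ} (hf : Decay f) {z : ℂ} (hz : ‖z‖ < 1) :
    ∃ D, HasDerivAt (genFun fun N => f N / N) D z ∧ D * z = genFun f z := by
  obtain ⟨C', hC'⟩ := hf.div.bounded
  obtain ⟨D, hD, hDz⟩ := hasDerivAt_genFun hC' hz
  refine ⟨D, hD, ?_⟩
  rw [hDz]
  refine tsum_congr fun N => ?_
  rcases N with _ | N
  · simp [hf.zero]
  · rw [mul_div_cancel₀ _ (Nat.cast_ne_zero.2 N.succ_ne_zero)]

theorem genFun_one_div {z : ℂ} (hz : ‖z‖ < 1) :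
    genFun (fun N => 1 / N) z = -log (1 - z) := by
  rw [← (hasSum_taylorSeries_neg_log hz).tsum_eq]
  refine tsum_congr fun N => ?_
  push_cast
  ring

theorem norm_div_sub_one_lt_one {x : ℝ} (hx : x ≤ 0) : ‖(x : ℂ) / (x - 1)‖ < 1 := by
  have : (x : ℂ) / (x - 1) = ((x / (x - 1) : ℝ) : ℂ) := by push_cast; rfl
  rw [this, norm_real, Real.norm_eq_abs, abs_div, div_lt_one (by
    rw [abs_pos]; linarith), abs_of_nonpos hx, abs_of_neg (by linarith)]
  linarith

theorem ofReal_mem_slitDomain {x : ℝ} (hx : x < 1) : (x : ℂ) ∈ slitDomain :=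
  Or.inl (by simpa using hx)

/-- `(-1)^{d(k)}` for the index `k` of weight `j + 1` with `J(k) = A ∩ {1, …, j}`. -/
def depthSign (A : Finset ℕ) (j : ℕ) : ℂ := (-1) ^ ((A ∩ Finset.Icc 1 j).card + 1)

theorem depthSign_succ (A : Finset ℕ) (j : ℕ) :
    depthSign A (j + 1) = if j + 1 ∈ A then -depthSign A j else depthSign A j := by
  unfold depthSign
  rw [← Finset.insert_Icc_right_eq_Icc_add_one (by omega)]
  split_ifs with h
  · rw [Finset.inter_insert_of_mem h, Finset.card_insert_of_notMem (by simp), pow_succ, mul_neg_one]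
  · rw [Finset.inter_insert_of_notMem h]

/-- The holomorphic continuation to `ℂ ∖ [1, ∞)` of the power series `∑ coeff A j N z ^ N`,
with Landen's formula on the negative real axis: in terms of `w = z / (z - 1)` one has
`dz / z = dw / w + dw / (1 - w)` and `dz / (1 - z) = - dw / (1 - w)`, so that integrating against
`dz / z` turns into the choice between keeping and adding a position. -/
theorem exists_continuation (A : Finset ℕ) (j : ℕ) :
    ∃ G : ℂ → ℂ, DifferentiableOn ℂ G slitDomain ∧ G 0 = 0 ∧
      (∀ z : ℂ, ‖z‖ < 1 → G z = genFun (coeff A j) z) ∧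
      ∀ x : ℝ, x ≤ 0 → G x = depthSign A j * genFun (refineCoeff A j) (x / (x - 1)) := by
  induction j with
  | zero =>
    refine ⟨fun z => -log (1 - z), fun z hz => ?_, by simp, fun z hz => ?_, fun x hx => ?_⟩
    · exact (((differentiableAt_id.const_sub 1).clog hz).neg).differentiableWithinAt
    · exact (genFun_one_div hz).symm
    · have e : (1 : ℂ) - x / (x - 1) = (1 - (x : ℂ))⁻¹ := by
        have h1 : (x : ℂ) - 1 ≠ 0 := by
          exact_mod_cast (by linarith : x - 1 < 0).ne
        have h2 : (1 : ℂ) - x ≠ 0 := by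
          exact_mod_cast (by linarith : 0 < 1 - x).ne'
        field_simp
        ring
      have h3 : genFun (refineCoeff A 0) (x / (x - 1)) = log (1 - x) := by
        refine (genFun_one_div (norm_div_sub_one_lt_one hx)).trans ?_
        rw [e, log_inv, neg_neg]
        exact (mem_slitPlane_iff_arg.1 (ofReal_mem_slitDomain (by linarith : x < 1))).1
      simp [h3, depthSign]
  | succ j ih =>
    obtain ⟨G, hGd, hG0, hGs, hGL⟩ := ih
    have hnhds : slitDomain ∈ 𝓝 (0 : ℂ) := isOpen_slitDomain.mem_nhds zero_mem_slitDomain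
    obtain ⟨G', hG'0, hG'⟩ : ∃ G' : ℂ → ℂ, G' 0 = 0 ∧ ∀ z ∈ slitDomain,
        ∃ D, HasDerivAt G' D z ∧ (z ≠ 0 → D = if j + 1 ∈ A then G z / (1 - z) else G z / z) := by
      by_cases hA : j + 1 ∈ A
      · obtain ⟨G', h0, h⟩ := exists_primitive (f := fun z => G z / (1 - z))
          (hGd.div (by fun_prop) fun z hz => one_sub_ne_zero_of_mem_slitDomain hz)
        exact ⟨G', h0, fun z hz => ⟨_, h z hz, fun _ => (if_pos hA).symm⟩⟩
      · obtain ⟨G', h0, h⟩ := exists_primitive ((differentiableOn_dslope hnhds).2 hGd)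
        refine ⟨G', h0, fun z hz => ⟨_, h z hz, fun hz0 => ?_⟩⟩
        rw [if_neg hA, dslope_of_ne _ hz0, slope_def_field, hG0, sub_zero, sub_zero]
    have hG'd : ∀ z ∈ slitDomain, DifferentiableAt ℂ G' z := fun z hz =>
      let ⟨_, h, _⟩ := hG' z hz
      h.differentiableAt
    refine ⟨G', fun z hz => (hG'd z hz).differentiableWithinAt, hG'0, fun z hz => ?_,
      fun x hx => ?_⟩
    · rcases eq_or_ne z 0 with rfl | hz0
      · rw [hG'0, genFun_zero (decay_coeff A _).zero]
      obtain ⟨C, hC⟩ := (decay_coeff A (j + 1)).bounded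
      have key := eq_of_hasDerivAt_zero_on_segment
        (H := fun z => G' z - genFun (coeff A (j + 1)) z) (z := z)
        ((hG'd 0 zero_mem_slitDomain).sub (differentiableAt_genFun hC (by simp))).continuousAt ?_
      · simpa [hG'0, genFun_zero (decay_coeff A _).zero, sub_eq_zero] using key
      intro t ht0 ht1
      have hy : ‖(t : ℂ) * z‖ < 1 := by
        rw [norm_mul, norm_real, Real.norm_eq_abs, abs_of_pos ht0]
        exact (mul_le_of_le_one_left (norm_nonneg z) ht1).trans_lt hz
      have hy0 : (t : ℂ) * z ≠ 0 := mul_ne_zero (by exact_mod_cast ht0.ne') hz0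
      set y := (t : ℂ) * z
      have hys := mem_slitDomain_of_norm_lt_one hy
      have hy1 := one_sub_ne_zero_of_mem_slitDomain hys
      obtain ⟨D, hD, hDe⟩ := hG' y hys
      specialize hDe hy0
      rw [hGs y hy] at hDe
      have : HasDerivAt (genFun (coeff A (j + 1))) D y := by
        by_cases hA : j + 1 ∈ A
        · obtain ⟨E, hE, hEe⟩ := hasDerivAt_genFun_sum (decay_coeff A j) hy
          have e : coeff A (j + 1) = fun N => (∑ m ∈ Finset.range N, coeff A j m) / N := by
            funext N
            simp [coeff, hA]
          rw [e, hDe, if_pos hA]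
          refine hE.congr_deriv ?_
          rw [eq_div_iff hy1]
          apply mul_left_cancel₀ hy0
          linear_combination hEe
        · obtain ⟨E, hE, hEe⟩ := hasDerivAt_genFun_div (decay_coeff A j) hy
          have e : coeff A (j + 1) = fun N => coeff A j N / N := by
            funext N
            simp [coeff, hA]
          rw [e, hDe, if_neg hA]
          refine hE.congr_deriv ?_
          rw [eq_div_iff hy0, hEe]
      have hsub := hD.sub this
      rw [sub_self] at hsub
      exact hsub
    · rcases eq_or_ne x 0 with rfl | hx0
      · simp [hG'0, genFun_zero (decay_refineCoeff A _).zero]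
      obtain ⟨C, hC⟩ := (decay_refineCoeff A (j + 1)).bounded
      have hw : ∀ y : ℂ, y ≠ 1 → HasDerivAt (fun y : ℂ => y / (y - 1)) (-1 / (y - 1) ^ 2) y := by
        intro y hy
        refine ((hasDerivAt_id y).div ((hasDerivAt_id y).sub_const 1)
          (sub_ne_zero.2 hy)).congr_deriv ?_
        simp
      have key := eq_of_hasDerivAt_zero_on_segment
        (H := fun z => G' z - depthSign A (j + 1) * genFun (refineCoeff A (j + 1)) (z / (z - 1)))
        (z := x) ?_ ?_
      · simpa [hG'0, genFun_zero (decay_refineCoeff A _).zero, sub_eq_zero] using key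
      · refine ((hG'd 0 zero_mem_slitDomain).sub (DifferentiableAt.const_mul ?_ _)).continuousAt
        refine DifferentiableAt.comp (g := genFun (refineCoeff A (j + 1)))
          (f := fun z : ℂ => z / (z - 1)) 0 (differentiableAt_genFun hC (by simp)) ?_
        exact (hw 0 zero_ne_one).differentiableAt
      intro t ht0 ht1
      have htx : t * x < 0 := mul_neg_of_pos_of_neg ht0 (lt_of_le_of_ne hx hx0)
      rw [← ofReal_mul]
      set y : ℝ := t * x
      have hy0 : (y : ℂ) ≠ 0 := by exact_mod_cast htx.ne
      have hys := ofReal_mem_slitDomain (htx.trans one_pos)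
      have hy1 : (1 : ℂ) - y ≠ 0 := one_sub_ne_zero_of_mem_slitDomain hys
      have hy2 : (y : ℂ) - 1 ≠ 0 := by
        rw [← neg_sub]
        exact neg_ne_zero.2 hy1
      have hwn := norm_div_sub_one_lt_one htx.le
      have hw0 : (y : ℂ) / (y - 1) ≠ 0 := div_ne_zero hy0 hy2
      have hw1 : 1 - (y : ℂ) / (y - 1) = -1 / (y - 1) := by
        field_simp
        ring
      obtain ⟨D, hD, hDe⟩ := hG' y hys
      specialize hDe hy0
      rw [hGL y htx.le] at hDe
      have hwy := hw y (sub_ne_zero.1 hy2)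
      have : ∃ E, HasDerivAt (genFun (refineCoeff A (j + 1))) E ((y : ℂ) / (y - 1)) ∧
          D = depthSign A (j + 1) * (E * (-1 / (y - 1) ^ 2)) := by
        by_cases hA : j + 1 ∈ A
        · obtain ⟨E, hE, hEe⟩ := hasDerivAt_genFun_sum (decay_refineCoeff A j) hwn
          have e : refineCoeff A (j + 1) =
              fun N => (∑ m ∈ Finset.range N, refineCoeff A j m) / N := by
            funext N
            simp [refineCoeff, hA]
          rw [e]
          refine ⟨E, hE, ?_⟩
          rw [hDe, if_pos hA, depthSign_succ, if_pos hA]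
          have hq : genFun (refineCoeff A j) ((y : ℂ) / (y - 1)) = -1 / (y - 1) * E := by
            apply mul_left_cancel₀ hw0
            rw [← hEe, hw1]
            ring
          rw [hq]
          have : (1 : ℂ) - y = -(y - 1) := by ring
          rw [this]
          field_simp
        · obtain ⟨E, hE, hEe⟩ := hasDerivAt_genFun_sum_succ (decay_refineCoeff A j) hwn
          have e : refineCoeff A (j + 1) =
              fun N => (∑ m ∈ Finset.range (N + 1), refineCoeff A j m) / N := by
            funext N
            simp [refineCoeff, hA]
          rw [e]
          refine ⟨E, hE, ?_⟩
          rw [hDe, if_neg hA, depthSign_succ, if_neg hA, ← hEe, hw1]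
          field_simp
      obtain ⟨E, hE, hDE⟩ := this
      have h := hD.sub ((HasDerivAt.comp (h := fun y : ℂ => y / (y - 1)) (y : ℂ) hE hwy).const_mul
        (depthSign A (j + 1)))
      rw [← hDE, sub_self] at h
      exact h

end KanekoTsumura

namespace KanekoTsumura

open Complex Set Filter Topology MeasureTheory

/-! ### The integral -/

/-- The functions `(1 - e^{-t})^N e^{-t} t^l`, into which the integrand of `η` is expanded. -/
noncomputable def kernel (N l : ℕ) (t : ℝ) : ℝ := (1 - Real.exp (-t)) ^ N * Real.exp (-t) * t ^ l

theorem one_sub_exp_neg_mem {t : ℝ} (ht : 0 < t) : 1 - Real.exp (-t) ∈ Ico (0 : ℝ) 1 := by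
  have h1 := Real.exp_pos (-t)
  have h2 : Real.exp (-t) < 1 := Real.exp_lt_one_iff.2 (by linarith)
  constructor <;> linarith

theorem kernel_nonneg (N l : ℕ) {t : ℝ} (ht : 0 < t) : 0 ≤ kernel N l t :=
  mul_nonneg (mul_nonneg (pow_nonneg (one_sub_exp_neg_mem ht).1 N) (Real.exp_pos _).le)
    (pow_nonneg ht.le l)

theorem kernel_le (N l : ℕ) {t : ℝ} (ht : 0 < t) : kernel N l t ≤ Real.exp (-t) * t ^ l := by
  have h := one_sub_exp_neg_mem ht
  refine mul_le_mul_of_nonneg_right ?_ (pow_nonneg ht.le l)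
  exact mul_le_of_le_one_left (Real.exp_pos _).le (pow_le_one₀ h.1 h.2.le)

theorem integrableOn_kernel (N l : ℕ) : IntegrableOn (kernel N l) (Ioi 0) := by
  have h := Real.GammaIntegral_convergent (s := l + 1) (by positivity)
  refine Integrable.mono' h ?_ ((ae_restrict_iff' measurableSet_Ioi).2 (.of_forall fun t ht => ?_))
  · exact Continuous.aestronglyMeasurable (by unfold kernel; fun_prop)
  · rw [Real.norm_eq_abs, abs_of_nonneg (kernel_nonneg N l ht), add_sub_cancel_right,
      Real.rpow_natCast]
    exact kernel_le N l ht

theorem hasDerivAt_one_sub_exp_neg_pow (N : ℕ) (t : ℝ) :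
    HasDerivAt (fun t : ℝ => (1 - Real.exp (-t)) ^ (N + 1))
      ((N + 1) * ((1 - Real.exp (-t)) ^ N * Real.exp (-t))) t := by
  have := (((hasDerivAt_neg t).exp).const_sub 1).pow (N + 1)
  refine this.congr_deriv ?_
  push_cast
  simp
  ring

theorem one_sub_pow_eq (N : ℕ) (t : ℝ) :
    1 - (1 - Real.exp (-t)) ^ N =
      ∑ m ∈ Finset.range N, (1 - Real.exp (-t)) ^ m * Real.exp (-t) := by
  rw [← Finset.sum_mul]
  have := geom_sum_mul (1 - Real.exp (-t)) N
  linear_combination this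

theorem integral_kernel_zero (N : ℕ) : ∫ t in Ioi 0, kernel N 0 t = 1 / (N + 1) := by
  have hN : (N + 1 : ℝ) ≠ 0 := by positivity
  have h := integral_Ioi_of_hasDerivAt_of_tendsto (a := 0) (m := 1)
    (f := fun t : ℝ => (1 - Real.exp (-t)) ^ (N + 1))
    (f' := fun t => (N + 1) * kernel N 0 t) (by fun_prop) (fun t _ => by
      simpa [kernel] using hasDerivAt_one_sub_exp_neg_pow N t)
    ((integrableOn_kernel N 0).const_mul _) (by
      have := ((Real.tendsto_exp_neg_atTop_nhds_zero).const_sub 1).pow (N + 1)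
      simpa using this)
  rw [integral_const_mul] at h
  simp only [neg_zero, Real.exp_zero, sub_self, ne_eq, Nat.add_eq_zero_iff, one_ne_zero, and_false,
    not_false_eq_true, zero_pow, sub_zero] at h
  rw [eq_div_iff hN, mul_comm, h]

/-- Integration by parts against `1 - (1 - e^{-t})^{N + 1} = ∑_{m ≤ N} (1 - e^{-t})^m e^{-t}`. -/
theorem integral_kernel_succ (N l : ℕ) :
    (N + 1) * ∫ t in Ioi 0, kernel N (l + 1) t =
      (l + 1) * ∑ m ∈ Finset.range (N + 1), ∫ t in Ioi 0, kernel m l t := by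
  have hsum : IntegrableOn (fun t => ∑ m ∈ Finset.range (N + 1), kernel m l t) (Ioi 0) :=
    integrable_finsetSum _ fun m _ => integrableOn_kernel m l
  have h := integral_Ioi_of_hasDerivAt_of_tendsto (a := 0) (m := 0)
    (f := fun t : ℝ => (1 - (1 - Real.exp (-t)) ^ (N + 1)) * t ^ (l + 1))
    (f' := fun t => (l + 1) * (∑ m ∈ Finset.range (N + 1), kernel m l t)
      - (N + 1) * kernel N (l + 1) t) (by fun_prop) (fun t _ => by
      refine (((hasDerivAt_one_sub_exp_neg_pow N t).const_sub 1).mul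
        (hasDerivAt_pow (l + 1) t)).congr_deriv ?_
      simp only [kernel]
      rw [← Finset.sum_mul, ← one_sub_pow_eq, Nat.add_sub_cancel]
      push_cast
      ring)
    ((hsum.const_mul _).sub ((integrableOn_kernel N (l + 1)).const_mul _)) (by
      have h0 : Tendsto (fun t : ℝ => (N + 1) * (t ^ (l + 1) * Real.exp (-t))) atTop (𝓝 0) := by
        simpa using (Real.tendsto_pow_mul_exp_neg_atTop_nhds_zero (l + 1)).const_mul (N + 1 : ℝ)
      refine squeeze_zero' (eventually_gt_atTop 0 |>.mono fun t ht => ?_)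
        (eventually_gt_atTop 0 |>.mono fun t ht => ?_) h0
      · have := one_sub_exp_neg_mem ht
        exact mul_nonneg (sub_nonneg.2 (pow_le_one₀ this.1 this.2.le)) (pow_nonneg ht.le _)
      · have hx := one_sub_exp_neg_mem ht
        rw [one_sub_pow_eq, mul_comm (t ^ (l + 1)), ← mul_assoc]
        refine mul_le_mul_of_nonneg_right ?_ (pow_nonneg ht.le _)
        refine (Finset.sum_le_card_nsmul _ _ (Real.exp (-t)) fun m _ =>
          mul_le_of_le_one_left (Real.exp_pos _).le (pow_le_one₀ hx.1 hx.2.le)).trans ?_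
        simp)
  rw [integral_sub (hsum.const_mul _) ((integrableOn_kernel N (l + 1)).const_mul _),
    integral_const_mul, integral_const_mul,
    integral_finsetSum _ fun m _ => integrableOn_kernel m l] at h
  simp at h
  linarith

theorem integral_kernel (l N : ℕ) :
    ∫ t in Ioi 0, kernel N l t = l.factorial * refineCoeff ∅ l (N + 1) := by
  induction l generalizing N with
  | zero => simp [integral_kernel_zero, refineCoeff]
  | succ l ih =>
    have hN : (N + 1 : ℝ) ≠ 0 := by positivity
    have h := integral_kernel_succ N l
    simp only [ih, ← Finset.mul_sum] at h
    apply mul_left_cancel₀ hN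
    rw [h]
    simp only [refineCoeff, Finset.notMem_empty, if_false]
    rw [Finset.sum_range_succ' _ (N + 1), (decay_refineCoeff ∅ l).zero, add_zero,
      Nat.factorial_succ]
    push_cast
    field_simp

theorem integrable_tsum_of_summable_integral_norm {α : Type*} [MeasurableSpace α] {μ : Measure α}
    {F : ℕ → α → ℂ} (hF : ∀ i, Integrable (F i) μ) (hs : Summable fun i => ∫ a, ‖F i a‖ ∂μ)
    (hm : AEStronglyMeasurable (fun a => ∑' i, F i a) μ) :
    Integrable (fun a => ∑' i, F i a) μ := by
  refine ⟨hm, ?_⟩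
  have h1 : ∫⁻ a, ‖∑' i, F i a‖ₑ ∂μ ≤ ∫⁻ a, ∑' i, ‖F i a‖ₑ ∂μ :=
    lintegral_mono fun a => enorm_tsum_le_tsum_enorm
  refine h1.trans_lt ?_
  rw [lintegral_tsum fun i => (hF i).1.enorm]
  have h2 : ∀ i, ∫⁻ a, ‖F i a‖ₑ ∂μ = ENNReal.ofReal (∫ a, ‖F i a‖ ∂μ) := fun i =>
    (ofReal_integral_norm_eq_lintegral_enorm (hF i)).symm
  simp_rw [h2]
  exact hs.tsum_ofReal_lt_top

/-- The integral of a function `G` that satisfies Landen's formula. -/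
theorem integral_landen {A : Finset ℕ} {j l : ℕ} {G : ℂ → ℂ} (hG : DifferentiableOn ℂ G slitDomain)
    (hL : ∀ x : ℝ, x ≤ 0 → G x = depthSign A j * genFun (refineCoeff A j) (x / (x - 1))) :
    IntegrableOn (fun t : ℝ => G (1 - exp t) / (1 - exp t) * (t : ℂ) ^ l) (Ioi 0) ∧
    ∫ t in Ioi (0 : ℝ), G (1 - exp t) / (1 - exp t) * (t : ℂ) ^ l =
      -depthSign A j * l.factorial *
        ((∑' N, refineCoeff A j N * refineCoeff ∅ l N : ℝ) : ℂ) := by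
  set a := refineCoeff A j
  have ha := decay_refineCoeff A j
  obtain ⟨C, hC⟩ := ha.bounded
  have ha0 : ∀ N, 0 ≤ a N := refineCoeff_nonneg A j
  -- the index is shifted by one, as `a 0 = 0`
  set F : ℕ → ℝ → ℂ := fun N t => ((a (N + 1) * kernel N l t : ℝ) : ℂ) with hF
  have hint : ∀ N, IntegrableOn (F N) (Ioi 0) := fun N =>
    ((integrableOn_kernel N l).const_mul (a (N + 1))).ofReal
  have hnorm : ∀ N, ∫ t in Ioi 0, ‖F N t‖ =
      l.factorial * (a (N + 1) * refineCoeff ∅ l (N + 1)) := by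
    intro N
    rw [setIntegral_congr_fun measurableSet_Ioi (g := fun t => a (N + 1) * kernel N l t),
      integral_const_mul, integral_kernel]
    · ring
    · intro t ht
      simp only [hF]
      rw [norm_real, Real.norm_eq_abs,
        abs_of_nonneg (mul_nonneg (ha0 _) (kernel_nonneg N l ht))]
  have hprod := ha.summable_mul (decay_refineCoeff ∅ l)
  have hs : Summable fun N => ∫ t in Ioi 0, ‖F N t‖ := by
    simp_rw [hnorm]
    exact ((summable_nat_add_iff 1).2 hprod).mul_left _
  have hpt : ∀ t ∈ Ioi (0 : ℝ), G (1 - exp t) / (1 - exp t) * (t : ℂ) ^ l =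
      -depthSign A j * ∑' N, F N t := by
    intro t ht
    have ht' : 0 < t := ht
    have hx := one_sub_exp_neg_mem ht'
    have he : 1 < Real.exp t := Real.one_lt_exp_iff.2 ht'
    have h1 := hL (1 - Real.exp t) (by linarith)
    have he0 : exp (t : ℂ) ≠ 0 := exp_ne_zero _
    have he1 : (1 : ℂ) - exp (t : ℂ) ≠ 0 := by
      rw [← ofReal_exp]
      exact_mod_cast (by linarith : 1 - Real.exp t < 0).ne
    push_cast at h1
    have hw : (1 - exp (t : ℂ)) / (1 - exp t - 1) = ((1 - Real.exp (-t) : ℝ) : ℂ) := by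
      push_cast
      rw [exp_neg]
      have : (1 : ℂ) - exp t - 1 = - exp t := by ring
      rw [this]
      field_simp
      ring
    rw [h1, hw, genFun, (summable_genFun hC (by
      rw [norm_real, Real.norm_eq_abs, abs_of_nonneg hx.1]; exact hx.2)).tsum_eq_zero_add,
      ha.zero, ofReal_zero, zero_mul, zero_add, mul_div_assoc, mul_assoc, neg_mul, ← mul_neg]
    congr 1
    rw [← tsum_neg, ← tsum_div_const, ← tsum_mul_right]
    refine tsum_congr fun N => ?_
    simp only [hF, kernel]
    push_cast
    rw [exp_neg, pow_succ]
    field_simp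
    ring
  have hm : AEStronglyMeasurable (fun t => -depthSign A j * ∑' N, F N t)
      (volume.restrict (Ioi 0)) := by
    have hc : ContinuousOn (fun t : ℝ => G (1 - exp t) / (1 - exp t) * (t : ℂ) ^ l) (Ioi 0) := by
      have hsub : ∀ t ∈ Ioi (0 : ℝ), 1 - exp (t : ℂ) ∈ slitDomain := fun t _ => by
        have := ofReal_mem_slitDomain (x := 1 - Real.exp t) (by linarith [Real.exp_pos t])
        push_cast at this
        exact this
      refine ((hG.continuousOn.comp (f := fun t : ℝ => 1 - exp (t : ℂ)) (by fun_prop) hsub).div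
        (by fun_prop) fun t ht => ?_).mul (by fun_prop)
      rw [← ofReal_exp]
      have he : 1 < Real.exp t := Real.one_lt_exp_iff.2 ht
      exact_mod_cast (by linarith : 1 - Real.exp t < 0).ne
    exact (hc.aestronglyMeasurable measurableSet_Ioi).congr
      ((ae_restrict_iff' measurableSet_Ioi).2 (.of_forall hpt))
  -- the sign is invertible, so measurability passes from the integrand to the bare series
  have hsign : depthSign A j * depthSign A j = 1 := by
    rw [depthSign, ← mul_pow]
    simp
  have hm' : AEStronglyMeasurable (fun t => ∑' N, F N t) (volume.restrict (Ioi 0)) := by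
    refine (hm.const_mul (-depthSign A j)).congr (.of_forall fun t => ?_)
    simp only
    rw [← mul_assoc, neg_mul_neg, hsign, one_mul]
  have hi := integrable_tsum_of_summable_integral_norm hint hs hm'
  refine ⟨IntegrableOn.congr_fun (hi.const_mul (-depthSign A j)) (fun t ht => (hpt t ht).symm)
    measurableSet_Ioi, ?_⟩
  rw [setIntegral_congr_fun measurableSet_Ioi hpt, integral_const_mul,
    ← integral_tsum_of_summable_integral_norm hint hs, mul_assoc]
  congr 1
  rw [hprod.tsum_eq_zero_add, ha.zero, zero_mul, zero_add, ofReal_tsum, ← tsum_mul_left]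
  refine tsum_congr fun N => ?_
  simp only [hF]
  refine (integral_ofReal (𝕜 := ℂ) (f := fun t => a (N + 1) * kernel N l t)).trans ?_
  rw [integral_const_mul, integral_kernel]
  simp only [a, coe_algebraMap]
  push_cast
  ring

end KanekoTsumura

namespace KanekoTsumura

open Set Filter Topology

/-! ### Sums over increasing sequences -/

/-- The sum of `1 / (n₁^{k₁} ⋯ n_r^{k_r})` over `0 < n₁ < ⋯ < n_r = N`, for the reversed list
`[k_r, …, k₁]`.  The empty sequence counts as ending in `0`, in accordance with `lastEntry`. -/
noncomputable def nested : List ℕ → ℕ → ℝ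
  | [], N => if N = 0 then 1 else 0
  | a :: k, N => (∑ m ∈ Finset.range N, nested k m) / (N : ℝ) ^ a

theorem nested_nonneg (k : List ℕ) (N : ℕ) : 0 ≤ nested k N := by
  induction k generalizing N with
  | nil =>
    simp only [nested]
    split_ifs <;> norm_num
  | cons a k ih =>
    exact div_nonneg (Finset.sum_nonneg fun m _ => ih m) (by positivity)

theorem lastEntry_snoc {r : ℕ} (n : Fin r → ℕ) (N : ℕ) :
    lastEntry (Fin.snoc (α := fun _ => ℕ) n N) = N := by
  rw [lastEntry, dif_pos r.succ_pos]
  exact Fin.snoc_last (α := fun _ => ℕ) N n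

theorem lastEntry_init_lt {r : ℕ} (n : IncTuple (r + 1)) :
    lastEntry (Fin.init n.1) < n.1 (Fin.last r) := by
  unfold lastEntry
  split_ifs with h
  · exact n.2.1 (by simp [Fin.lt_def]; omega)
  · exact n.2.2 _

theorem le_lastEntry {r : ℕ} (n : IncTuple r) (i : Fin r) : n.1 i ≤ lastEntry n.1 := by
  rw [lastEntry, dif_pos i.pos]
  exact n.2.1.monotone (by simp [Fin.le_def]; omega)

/-- An increasing sequence is its initial part followed by a number larger than the last entry of
that part. -/
def incTupleSnocEquiv (r : ℕ) :
    IncTuple (r + 1) ≃ Σ n : IncTuple r, {N : ℕ // lastEntry n.1 < N} where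
  toFun n := ⟨⟨Fin.init n.1, fun _ _ h => n.2.1 (Fin.castSucc_lt_castSucc_iff.2 h),
    fun _ => n.2.2 _⟩, ⟨n.1 (Fin.last r), lastEntry_init_lt n⟩⟩
  invFun p := ⟨Fin.snoc (α := fun _ => ℕ) p.1.1 p.2.1, by
    have hpos : 0 < p.2.1 := (Nat.zero_le _).trans_lt p.2.2
    constructor
    · intro i j hij
      induction j using Fin.lastCases with
      | last =>
        induction i using Fin.lastCases with
        | last => exact absurd hij (lt_irrefl _)
        | cast i =>
          simp only [Fin.snoc_castSucc, Fin.snoc_last]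
          exact (le_lastEntry p.1 i).trans_lt p.2.2
      | cast j =>
        induction i using Fin.lastCases with
        | last => exact absurd (hij.trans (Fin.castSucc_lt_last j)) (lt_irrefl _)
        | cast i =>
          simp only [Fin.snoc_castSucc]
          exact p.1.2.1 (Fin.castSucc_lt_castSucc_iff.1 hij)
    · intro i
      induction i using Fin.lastCases with
      | last => simpa only [Fin.snoc_last] using hpos
      | cast i => simpa only [Fin.snoc_castSucc] using p.1.2.2 i⟩
  left_inv n := Subtype.ext (Fin.snoc_init_self (α := fun _ => ℕ) n.1)
  right_inv p := Sigma.subtype_ext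
    (Subtype.ext (Fin.init_snoc (α := fun _ => ℕ) p.2.1 p.1.1))
    (Fin.snoc_last (α := fun _ => ℕ) p.2.1 p.1.1)

theorem tsum_incTuple {r : ℕ} (κ : Fin r → ℕ) (φ : ℕ → ENNReal) :
    ∑' n : IncTuple r, φ (lastEntry n.1) * ENNReal.ofReal (1 / ∏ i, (n.1 i : ℝ) ^ κ i) =
      ∑' N, φ N * ENNReal.ofReal (nested (List.ofFn κ).reverse N) := by
  induction r generalizing φ with
  | zero =>
    have : Unique (IncTuple 0) :=
      ⟨⟨⟨Fin.elim0, fun i => i.elim0, fun i => i.elim0⟩⟩, fun n =>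
        Subtype.ext (by ext i; exact i.elim0)⟩
    rw [tsum_eq_single (0 : ℕ) (fun N hN => by simp [nested, hN]), tsum_fintype,
      Fintype.sum_unique]
    simp [nested, lastEntry]
  | succ r ih =>
    set a := κ (Fin.last r)
    have hl : (List.ofFn κ).reverse = a :: (List.ofFn fun i => κ (Fin.castSucc i)).reverse := by
      rw [List.ofFn_succ', List.concat_eq_append, List.reverse_append]
      rfl
    rw [hl, ← (incTupleSnocEquiv r).symm.tsum_eq, ENNReal.tsum_sigma']
    set L := (List.ofFn fun i => κ (Fin.castSucc i)).reverse
    set w : ℕ → ENNReal := fun N => φ N * ENNReal.ofReal (1 / (N : ℝ) ^ a)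
    have h1 : ∀ n : IncTuple r, (∑' N : {N : ℕ // lastEntry n.1 < N},
        φ (lastEntry ((incTupleSnocEquiv r).symm ⟨n, N⟩).1) *
          ENNReal.ofReal (1 / ∏ i, (((incTupleSnocEquiv r).symm ⟨n, N⟩).1 i : ℝ) ^ κ i)) =
        (∑' N : {N : ℕ // lastEntry n.1 < N}, w N) *
          ENNReal.ofReal (1 / ∏ i, (n.1 i : ℝ) ^ κ (Fin.castSucc i)) := by
      intro n
      rw [← ENNReal.tsum_mul_right]
      refine tsum_congr fun N => ?_
      have e : ((incTupleSnocEquiv r).symm ⟨n, N⟩).1 = Fin.snoc (α := fun _ => ℕ) n.1 N.1 := rfl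
      rw [e, lastEntry_snoc, Fin.prod_univ_castSucc]
      simp only [Fin.snoc_castSucc, Fin.snoc_last, w]
      rw [mul_assoc, ← ENNReal.ofReal_mul (by positivity), one_div_mul_one_div,
        mul_comm (_ ^ κ (Fin.last r))]
    simp_rw [h1]
    refine (ih (fun i => κ (Fin.castSucc i))
      (fun M => ∑' N : {N : ℕ // M < N}, w N)).trans ?_
    have h2 : ∀ M, (∑' N : {N : ℕ // M < N}, w N) * ENNReal.ofReal (nested L M) =
        ∑' N, if M < N then w N * ENNReal.ofReal (nested L M) else 0 := by
      intro M
      rw [← ENNReal.tsum_mul_right]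
      refine (tsum_subtype {N | M < N} fun N => w N * ENNReal.ofReal (nested L M)).trans ?_
      exact tsum_congr fun N => by simp [indicator_apply]
    change ∑' M, (∑' N : {N : ℕ // M < N}, w N) * ENNReal.ofReal (nested L M) = _
    simp_rw [h2]
    rw [ENNReal.tsum_comm]
    refine tsum_congr fun N => ?_
    rw [tsum_eq_sum (s := Finset.range N) (fun M hM => if_neg (by simpa using hM)),
      Finset.sum_congr rfl (fun M hM => if_pos (Finset.mem_range.1 hM)), ← Finset.mul_sum,
      ← ENNReal.ofReal_sum_of_nonneg fun M _ => nested_nonneg L M]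
    simp only [nested, w]
    rw [mul_assoc, ← ENNReal.ofReal_mul (by positivity), one_div, inv_mul_eq_div]

theorem tsum_mzvTerm (k : List ℕ) (φ : ℕ → ENNReal) :
    ∑' n : IncTuple k.length, φ (lastEntry n.1) * ENNReal.ofReal (mzvTerm k n) =
      ∑' N, φ N * ENNReal.ofReal (nested k.reverse N) := by
  have := tsum_incTuple k.get φ
  rwa [List.ofFn_get] at this

theorem mzvTerm_nonneg (k : List ℕ) (n : IncTuple k.length) : 0 ≤ mzvTerm k n := by
  unfold mzvTerm
  positivity

/-- The terms whose last entry is `N` add up to `nested k.reverse N`. -/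
theorem hasSum_mzvTerm_fiber (k : List ℕ) (N : ℕ) :
    HasSum (fun n : {n : IncTuple k.length // lastEntry n.1 = N} => mzvTerm k n.1)
      (nested k.reverse N) := by
  have h := tsum_mzvTerm k fun M => if M = N then 1 else 0
  rw [tsum_eq_single N (fun M hM => by simp [hM]), if_pos rfl, one_mul] at h
  have h2 : ∑' n : {n : IncTuple k.length // lastEntry n.1 = N},
      ENNReal.ofReal (mzvTerm k n.1) = ENNReal.ofReal (nested k.reverse N) := by
    rw [← h]
    refine (tsum_subtype {n : IncTuple k.length | lastEntry n.1 = N}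
      fun n => ENNReal.ofReal (mzvTerm k n)).trans ?_
    exact tsum_congr fun n => by simp [indicator_apply]
  have h3 := ENNReal.hasSum_toReal (h2 ▸ ENNReal.ofReal_ne_top)
  rw [← ENNReal.tsum_toReal_eq fun _ => ENNReal.ofReal_ne_top, h2,
    ENNReal.toReal_ofReal (nested_nonneg _ N)] at h3
  simpa only [ENNReal.toReal_ofReal (mzvTerm_nonneg k _)] using h3

/-- A weight depending only on the last entry `N` may be summed against `nested k.reverse N`:
constant weights give multiple zeta values, `z ^ N` gives multiple polylogarithms. -/
theorem hasSum_mzvTerm {𝕜 : Type*} [RCLike 𝕜] (k : List ℕ) (φ : ℕ → 𝕜)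
    (h : Summable fun N => ‖φ N‖ * nested k.reverse N) :
    HasSum (fun n : IncTuple k.length => φ (lastEntry n.1) * (mzvTerm k n : 𝕜))
      (∑' N, φ N * (nested k.reverse N : 𝕜)) := by
  have hs : Summable fun n : IncTuple k.length => φ (lastEntry n.1) * (mzvTerm k n : 𝕜) := by
    refine Summable.of_norm (tsum_enorm_ne_top_iff_summable_norm.1 ?_)
    have e : ∀ x : ℝ, 0 ≤ x → ‖(x : 𝕜)‖ₑ = ENNReal.ofReal x := fun x hx => by
      rw [← ofReal_norm, RCLike.norm_ofReal, abs_of_nonneg hx]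
    simp_rw [enorm_mul, e _ (mzvTerm_nonneg k _)]
    rw [tsum_mzvTerm k fun N => ‖φ N‖ₑ]
    have : ∀ N, ‖φ N‖ₑ * ENNReal.ofReal (nested k.reverse N) =
        ENNReal.ofReal (‖φ N‖ * nested k.reverse N) := fun N => by
      rw [ENNReal.ofReal_mul (norm_nonneg _), ofReal_norm]
    simp_rw [this]
    exact h.tsum_ofReal_lt_top.ne
  have h1 := hs.hasSum
  have e : ∑' n : IncTuple k.length, φ (lastEntry n.1) * (mzvTerm k n : 𝕜) =
      ∑' N, φ N * (nested k.reverse N : 𝕜) := by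
    set q := Equiv.sigmaFiberEquiv fun n : IncTuple k.length => lastEntry n.1
    have hs' : Summable
        ((fun n : IncTuple k.length => φ (lastEntry n.1) * (mzvTerm k n : 𝕜)) ∘ q) :=
      q.summable_iff.2 hs
    rw [← q.tsum_eq]
    refine hs'.tsum_sigma.trans (tsum_congr fun N => ?_)
    have h2 : HasSum (fun n : {n : IncTuple k.length // lastEntry n.1 = N} =>
        ((mzvTerm k n.1 : ℝ) : 𝕜)) (nested k.reverse N : ℝ) :=
      RCLike.hasSum_ofReal 𝕜 |>.2 (hasSum_mzvTerm_fiber k N)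
    rw [← (h2.mul_left (φ N)).tsum_eq]
    refine tsum_congr fun n => ?_
    change φ (lastEntry n.1.1) * _ = _
    rw [n.2]
    rfl
  rwa [e] at h1

end KanekoTsumura

namespace KanekoTsumura

/-! ### The harmonic product -/

/-- The linear extension to formal sums of a function on indices. -/
noncomputable def ev (ψ : List ℕ → ℝ) : (List ℕ →₀ ℤ) →+ ℝ :=
  Finsupp.liftAddHom fun m => (AddMonoidHom.mulRight (ψ m)).comp (Int.castAddHom ℝ)

theorem ev_apply (ψ : List ℕ → ℝ) (α : List ℕ →₀ ℤ) : ev ψ α = α.sum fun m a => (a : ℝ) * ψ m :=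
  rfl

theorem ev_single (ψ : List ℕ → ℝ) (m : List ℕ) : ev ψ (Finsupp.single m 1) = ψ m := by
  simp [ev]

theorem ev_mapDomain (ψ : List ℕ → ℝ) (g : List ℕ → List ℕ) (α : List ℕ →₀ ℤ) :
    ev ψ (α.mapDomain g) = ev (fun m => ψ (g m)) α := by
  rw [ev_apply, ev_apply, Finsupp.sum_mapDomain_index (by simp) (by intros; push_cast; ring)]

theorem ev_sum {ι : Type*} (s : Finset ι) (ψ : ι → List ℕ → ℝ) (α : List ℕ →₀ ℤ) :
    ev (fun m => ∑ i ∈ s, ψ i m) α = ∑ i ∈ s, ev (ψ i) α := by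
  simp only [ev_apply, Finsupp.sum, Finset.mul_sum]
  exact Finset.sum_comm

theorem ev_div (ψ : List ℕ → ℝ) (c : ℝ) (α : List ℕ →₀ ℤ) :
    ev (fun m => ψ m / c) α = ev ψ α / c := by
  simp only [ev_apply, Finsupp.sum, Finset.sum_div, mul_div_assoc]

/-- The truncated sum over `n₁ < ⋯ < n_r < N`, for reversed lists. -/
noncomputable def truncated (N : ℕ) (k : List ℕ) : ℝ := ∑ m ∈ Finset.range N, nested k m

theorem nested_cons (a : ℕ) (k : List ℕ) (N : ℕ) :
    nested (a :: k) N = truncated N k / (N : ℝ) ^ a := rfl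

theorem ev_truncated_cons (N a : ℕ) (α : List ℕ →₀ ℤ) :
    ev (truncated N) (α.mapDomain (a :: ·)) =
      ∑ m ∈ Finset.range N, ev (truncated m) α / (m : ℝ) ^ a := by
  rw [ev_mapDomain]
  simp only [truncated, nested_cons]
  rw [ev_sum]
  exact Finset.sum_congr rfl fun m _ => ev_div _ _ _

theorem sum_range_mul_sum_range (f g : ℕ → ℝ) (N : ℕ) :
    (∑ m ∈ Finset.range N, f m) * ∑ m ∈ Finset.range N, g m =
      ∑ m ∈ Finset.range N, (f m * ∑ i ∈ Finset.range m, g i +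
        (∑ i ∈ Finset.range m, f i) * g m + f m * g m) := by
  induction N with
  | zero => simp
  | succ N ih =>
    simp only [Finset.sum_range_succ]
    rw [← ih]
    ring

theorem truncated_nil (N : ℕ) : truncated N [] = if N = 0 then 0 else 1 := by
  rcases N with _ | N <;> simp [truncated, nested]

theorem truncated_zero (k : List ℕ) : truncated 0 k = 0 := by simp [truncated]

theorem truncated_mul (N : ℕ) (k l : List ℕ) :
    truncated N k * truncated N l = ev (truncated N) (harmonicRev k l) := by
  induction k, l using harmonicRev.induct generalizing N with
  | case1 l =>
    rw [harmonicRev, ev_single, truncated_nil]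
    split_ifs with h
    · rw [h, truncated_zero, mul_zero]
    · rw [one_mul]
  | case2 a k =>
    rw [harmonicRev, ev_single, truncated_nil]
    split_ifs with h
    · rw [h, truncated_zero, mul_zero]
    · rw [mul_one]
  | case3 a k b l ih1 ih2 ih3 =>
    rw [harmonicRev, map_add, map_add, ev_truncated_cons, ev_truncated_cons, ev_truncated_cons]
    simp only [← ih1, ← ih2, ← ih3, ← Finset.sum_add_distrib]
    rw [truncated, truncated, sum_range_mul_sum_range]
    refine Finset.sum_congr rfl fun m _ => ?_
    change nested (a :: k) m * truncated m (b :: l) +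
      truncated m (a :: k) * nested (b :: l) m + _ = _
    rw [nested_cons, nested_cons, pow_add, div_mul_div_comm]
    ring

theorem nested_mul (k l : List ℕ) (a b N : ℕ) :
    nested (a :: k) N * nested (b :: l) N =
      ev (fun m => nested ((a + b) :: m) N) (harmonicRev k l) := by
  simp only [nested_cons]
  rw [ev_div, ← truncated_mul, pow_add, div_mul_div_comm]

/-- The product `⊛` multiplies the sums with prescribed last entry. -/
theorem ev_circ (k l : List ℕ) (hk : k ≠ []) (hl : l ≠ []) (N : ℕ) :
    ev (fun m => nested m.reverse N) (circ k l) =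
      nested k.reverse N * nested l.reverse N := by
  obtain ⟨k, a, rfl⟩ := List.eq_nil_or_concat k |>.resolve_left hk
  obtain ⟨l, b, rfl⟩ := List.eq_nil_or_concat l |>.resolve_left hl
  rw [circ, ev_mapDomain, harmonic, ev_mapDomain]
  simp [nested_mul, List.getLastD_eq_getLast?]

theorem pos_of_mem_support_harmonicRev (k l : List ℕ) (hk : ∀ a ∈ k, 0 < a) (hl : ∀ b ∈ l, 0 < b)
    {m : List ℕ} (hm : m ∈ (harmonicRev k l).support) : ∀ c ∈ m, 0 < c := by
  have cons : ∀ (α : List ℕ →₀ ℤ) (a : ℕ) (m : List ℕ), 0 < a →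
      (∀ m ∈ α.support, ∀ c ∈ m, 0 < c) → m ∈ (α.mapDomain (a :: ·)).support →
      ∀ c ∈ m, 0 < c := by
    intro α a m ha hα hm
    classical
    obtain ⟨m', hm', rfl⟩ := Finset.mem_image.1 (Finsupp.mapDomain_support hm)
    exact List.forall_mem_cons.2 ⟨ha, hα m' hm'⟩
  have single : ∀ m m' : List ℕ, m ∈ (Finsupp.single m' (1 : ℤ)).support → m = m' := by
    intro m m' h
    simpa using Finsupp.support_single_subset h
  induction k, l using harmonicRev.induct generalizing m with
  | case1 l =>
    rw [harmonicRev] at hm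
    rwa [single _ _ hm]
  | case2 a k =>
    rw [harmonicRev] at hm
    rwa [single _ _ hm]
  | case3 a k b l ih1 ih2 ih3 =>
    rw [harmonicRev] at hm
    have hk' := List.forall_mem_cons.1 hk
    have hl' := List.forall_mem_cons.1 hl
    classical
    rcases Finset.mem_union.1 (Finsupp.support_add hm) with hm | hm
    · rcases Finset.mem_union.1 (Finsupp.support_add hm) with hm | hm
      · exact cons _ a m hk'.1 (fun m hm => ih1 hk'.2 hl hm) hm
      · exact cons _ b m hl'.1 (fun m hm => ih2 hk hl'.2 hm) hm
    · exact cons _ (a + b) m (by omega) (fun m hm => ih3 hk'.2 hl'.2 hm) hm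

/-- The indices occurring in `k ⊛ l` have last entry at least `2`. -/
theorem exists_of_mem_support_circ (k l : List ℕ) (hk0 : k ≠ []) (hl0 : l ≠ [])
    (hk : ∀ a ∈ k, 0 < a) (hl : ∀ b ∈ l, 0 < b) {m : List ℕ} (hm : m ∈ (circ k l).support) :
    ∃ c t, m.reverse = c :: t ∧ 2 ≤ c ∧ ∀ x ∈ t, 0 < x := by
  obtain ⟨k, a, rfl⟩ := List.eq_nil_or_concat k |>.resolve_left hk0
  obtain ⟨l, b, rfl⟩ := List.eq_nil_or_concat l |>.resolve_left hl0
  classical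
  obtain ⟨m', hm', rfl⟩ := Finset.mem_image.1 (Finsupp.mapDomain_support hm)
  obtain ⟨m'', hm'', rfl⟩ := Finset.mem_image.1 (Finsupp.mapDomain_support hm')
  simp only [List.concat_eq_append, List.mem_append, List.mem_singleton] at hk hl
  have ha := hk a (Or.inr rfl)
  have hb := hl b (Or.inr rfl)
  refine ⟨a + b, m'', by simp [List.getLastD_eq_getLast?], by omega, ?_⟩
  refine pos_of_mem_support_harmonicRev _ _ ?_ ?_ hm''
  · intro x hx
    exact hk x (Or.inl (by simpa using hx))
  · intro x hx
    exact hl x (Or.inl (by simpa using hx))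

/-! ### Convergence of multiple zeta values -/

theorem Decay.mono {f g : ℕ → ℝ} (hg : Decay g) (h : ∀ N, |f N| ≤ |g N|) : Decay f :=
  let ⟨C, hC⟩ := hg
  ⟨C, fun N => (h N).trans (hC N)⟩

theorem abs_nested_cons_le {a : ℕ} (ha : 0 < a) (k : List ℕ) (N : ℕ) :
    |nested (a :: k) N| ≤ |truncated N k / N| := by
  rw [nested_cons, abs_div, abs_div]
  rcases Nat.eq_zero_or_pos N with rfl | hN
  · simp [truncated_zero]
  · rw [abs_of_nonneg (a := (N : ℝ) ^ a) (by positivity),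
      abs_of_nonneg (a := (N : ℝ)) (Nat.cast_nonneg N)]
    have h1N : (1 : ℝ) ≤ N := by exact_mod_cast hN
    exact div_le_div_of_nonneg_left (abs_nonneg _) (by positivity) (le_self_pow₀ h1N ha.ne')

theorem decay_truncated_div (k : List ℕ) (hk : ∀ b ∈ k, 0 < b) :
    Decay fun N => truncated N k / N := by
  induction k with
  | nil =>
    refine decay_one_div.mono fun N => ?_
    rw [truncated_nil]
    split_ifs <;> simp [*]
  | cons b k ih =>
    have hk' := List.forall_mem_cons.1 hk
    exact ((ih hk'.2).mono (abs_nested_cons_le hk'.1 k)).sum_div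

theorem decay_nested (a : ℕ) (k : List ℕ) (ha : 0 < a) (hk : ∀ b ∈ k, 0 < b) :
    Decay (nested (a :: k)) :=
  (decay_truncated_div k hk).mono (abs_nested_cons_le ha k)

theorem summable_nested (c : ℕ) (t : List ℕ) (hc : 2 ≤ c) (ht : ∀ x ∈ t, 0 < x) :
    Summable (nested (c :: t)) := by
  obtain ⟨c, rfl⟩ : ∃ d, c = d + 1 := ⟨c - 1, by omega⟩
  have h := (decay_nested c t (by omega) ht).summable_mul decay_one_div
  refine h.congr fun N => ?_
  rw [nested_cons, nested_cons, pow_succ, ← div_div, mul_one_div]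

theorem summable_mzvTerm {m : List ℕ} (h : Summable (nested m.reverse)) :
    Summable (mzvTerm m) := by
  have := hasSum_mzvTerm (𝕜 := ℝ) m (fun _ => 1) (by simpa using h)
  simpa using this.summable

theorem mzv_eq_tsum {m : List ℕ} (h : Summable (nested m.reverse)) :
    mzv m = ∑' N, nested m.reverse N := by
  have := hasSum_mzvTerm (𝕜 := ℝ) m (fun _ => 1) (by simpa using h)
  simpa [mzv] using this.tsum_eq

theorem summable_nested_of_mem_support_circ {k l : List ℕ} (hk0 : k ≠ []) (hl0 : l ≠ [])
    (hk : ∀ a ∈ k, 0 < a) (hl : ∀ b ∈ l, 0 < b) {m : List ℕ} (hm : m ∈ (circ k l).support) :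
    Summable (nested m.reverse) := by
  obtain ⟨c, t, e, hc, ht⟩ := exists_of_mem_support_circ k l hk0 hl0 hk hl hm
  rw [e]
  exact summable_nested c t hc ht

theorem mzvLin_circ {k l : List ℕ} (hk0 : k ≠ []) (hl0 : l ≠ [])
    (hk : ∀ a ∈ k, 0 < a) (hl : ∀ b ∈ l, 0 < b) :
    mzvLin (circ k l) = ∑' N, nested k.reverse N * nested l.reverse N := by
  have hs := fun m hm => summable_nested_of_mem_support_circ hk0 hl0 hk hl (m := m) hm
  have h1 : mzvLin (circ k l) = ∑ m ∈ (circ k l).support,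
      ∑' N, (circ k l m : ℝ) * nested m.reverse N := by
    refine Finset.sum_congr rfl fun m hm => ?_
    rw [tsum_mul_left, ← mzv_eq_tsum (hs m hm)]
  rw [h1, ← Summable.tsum_finsetSum fun m hm => (hs m hm).mul_left _]
  exact tsum_congr fun N => ev_circ k l hk0 hl0 N

/-- The pairing `⊛` of sums of indices. -/
theorem circLin_sum {ι κ : Type*} (s : Finset ι) (t : Finset κ) (f : ι → List ℕ)
    (g : κ → List ℕ) :
    circLin (∑ i ∈ s, Finsupp.single (f i) 1) (∑ j ∈ t, Finsupp.single (g j) 1) =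
      ∑ i ∈ s, ∑ j ∈ t, circ (f i) (g j) := by
  have h1 : ∀ k : List ℕ, ∀ a : ℤ, ((∑ j ∈ t, Finsupp.single (g j) (1 : ℤ)).sum
      fun l b => (a * b) • circ k l) = a • ∑ j ∈ t, circ k (g j) := by
    intro k a
    rw [← Finsupp.sum_finsetSum_index (by simp) (by intros; rw [mul_add, add_smul]),
      Finset.smul_sum]
    exact Finset.sum_congr rfl fun j _ => by simp
  unfold circLin
  simp_rw [h1]
  rw [← Finsupp.sum_finsetSum_index (by simp) (by intros; rw [add_smul])]
  exact Finset.sum_congr rfl fun i _ => by simp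

theorem mzvLin_sum {ι : Type*} (s : Finset ι) (α : ι → List ℕ →₀ ℤ) :
    mzvLin (∑ i ∈ s, α i) = ∑ i ∈ s, mzvLin (α i) :=
  map_sum (ev mzv) α s

end KanekoTsumura

namespace KanekoTsumura

/-! ### Indices as sets of partial sums -/

theorem coeff_congr {A B : Finset ℕ} {j : ℕ} (h : ∀ i ∈ Finset.Icc 1 j, (i ∈ A ↔ i ∈ B)) :
    coeff A j = coeff B j := by
  induction j with
  | zero => rfl
  | succ j ih =>
    have ih := ih fun i hi => h i (Finset.Icc_subset_Icc_right j.le_succ hi)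
    funext N
    simp only [coeff, ih, h (j + 1) (Finset.right_mem_Icc.2 (by omega))]

theorem coeff_add_of_notMem {A : Finset ℕ} {i d : ℕ} (h : ∀ m, i < m → m ≤ i + d → m ∉ A) (N : ℕ) :
    coeff A (i + d) N = coeff A i N / (N : ℝ) ^ d := by
  induction d with
  | zero => simp
  | succ d ih =>
    rw [← add_assoc, coeff, if_neg (h _ (by omega) (by omega)),
      ih fun m h1 h2 => h m h1 (by omega), pow_succ, div_div]

/-- In a reversed index the partial sums are the sums of the suffixes. -/
theorem nested_eq_coeff (L : List ℕ) (hL0 : L ≠ []) (hL : ∀ a ∈ L, 0 < a) (B : Finset ℕ)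
    (hB : ∀ m, 0 < m → m < L.sum → (m ∈ B ↔ ∃ T, T <:+ L ∧ T.sum = m)) :
    nested L = coeff B (L.sum - 1) := by
  induction L with
  | nil => exact absurd rfl hL0
  | cons a t ih =>
    have hL' := List.forall_mem_cons.1 hL
    obtain ⟨a, rfl⟩ : ∃ d, a = d + 1 := ⟨a - 1, by have := hL'.1; omega⟩
    have hgap : ∀ m, t.sum < m → m ≤ t.sum + a → m ∉ B := by
      intro m h1 h2 hm
      obtain ⟨T, hT, rfl⟩ := (hB m (by omega) (by rw [List.sum_cons]; omega)).1 hm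
      rcases List.suffix_cons_iff.1 hT with rfl | hT
      · rw [List.sum_cons] at h2
        omega
      · have := hT.sublist.sum_le_sum (by simp)
        omega
    funext N
    have e : ((a + 1) :: t).sum - 1 = t.sum + a := by
      rw [List.sum_cons]
      omega
    rw [e, coeff_add_of_notMem hgap, nested_cons]
    have key : truncated N t / N = coeff B t.sum N := by
      rcases t with _ | ⟨b, t⟩
      · rw [truncated_nil]
        rcases N with _ | N <;> simp [coeff]
      · have hb := (List.forall_mem_cons.1 hL'.2).1
        obtain ⟨s, hs⟩ : ∃ s, (b :: t).sum = s + 1 := ⟨(b :: t).sum - 1, by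
          rw [List.sum_cons]
          omega⟩
        have h1 := ih (by simp) hL'.2 (by
          intro m h1 h2
          rw [hB m h1 (by rw [List.sum_cons]; omega)]
          refine exists_congr fun T => and_congr_left fun hT => ?_
          rw [List.suffix_cons_iff]
          refine or_iff_right ?_
          rintro rfl
          rw [List.sum_cons] at hT
          omega)
        have hmem : s + 1 ∈ B :=
          (hB (s + 1) (by omega) (by rw [List.sum_cons, hs]; omega)).2
            ⟨b :: t, List.suffix_cons _ _, hs⟩
        rw [hs, coeff, if_pos hmem, truncated, h1, hs]
        rfl
    rw [← key, pow_succ', div_div]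

theorem mem_J_iff_suffix {n : ℕ} (k : Composition n) {m : ℕ} (h0 : 0 < m) (hn : m < n) :
    m ∈ J k ↔ ∃ T, T <:+ k.blocks.reverse ∧ T.sum = m := by
  simp only [J, Finset.mem_image, Finset.mem_Ico]
  constructor
  · rintro ⟨i, -, rfl⟩
    refine ⟨(k.blocks.take i).reverse, ?_, by simp [Composition.sizeUpTo]⟩
    rw [List.reverse_suffix]
    exact List.take_prefix _ _
  · rintro ⟨T, hT, rfl⟩
    rw [← List.reverse_reverse T, List.reverse_suffix] at hT
    have h1 := List.prefix_iff_eq_take.1 hT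
    have h2 : k.sizeUpTo T.reverse.length = T.sum := by
      rw [Composition.sizeUpTo, ← h1, List.sum_reverse]
    refine ⟨T.reverse.length, ⟨?_, ?_⟩, h2⟩
    · by_contra h
      rw [show T.reverse.length = 0 by omega, k.sizeUpTo_zero] at h2
      omega
    · by_contra h
      rw [k.sizeUpTo_ofLength_le _ (by omega)] at h2
      omega

theorem nested_blocks {n : ℕ} (hn : 0 < n) (k : Composition n) :
    nested k.blocks.reverse = coeff (J k) (n - 1) := by
  have hs : k.blocks.reverse.sum = n := by rw [List.sum_reverse, k.blocks_sum]
  have h := nested_eq_coeff k.blocks.reverse (by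
      intro h
      rw [h] at hs
      simp at hs
      omega) (fun a ha => k.blocks_pos (by simpa using ha)) (J k) (by
      intro m h0 hm
      rw [hs] at hm
      exact mem_J_iff_suffix k h0 hm)
  rwa [hs] at h

theorem J_subset {n : ℕ} (k : Composition n) : J k ⊆ Finset.Ico 1 n := by
  intro m hm
  obtain ⟨h0, hn, -⟩ := (mem_J_iff k m).1 hm
  exact Finset.mem_Ico.2 ⟨h0, hn⟩

theorem exists_J_eq {n : ℕ} {B : Finset ℕ} (hB : B ⊆ Finset.Ico 1 n) :
    ∃ k : Composition n, J k = B := by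
  refine ⟨CompositionAsSet.toComposition
    { boundaries := Finset.univ.filter fun i => i = 0 ∨ i = Fin.last n ∨ (i : ℕ) ∈ B
      zero_mem := by simp
      getLast_mem := by simp }, ?_⟩
  ext m
  rw [mem_J_iff]
  simp only [CompositionAsSet.toComposition_boundaries, Finset.mem_filter, Finset.mem_univ,
    true_and, Fin.ext_iff, Fin.val_zero, Fin.val_last]
  constructor
  · rintro ⟨h0, hn, h | h | h⟩
    · omega
    · omega
    · exact h
  · intro h
    have := Finset.mem_Ico.1 (hB h)
    exact ⟨by omega, by omega, Or.inr (Or.inr h)⟩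

theorem length_eq_card_J {n : ℕ} (hn : 0 < n) (k : Composition n) : k.length = (J k).card + 1 := by
  have hl := k.length_pos_of_pos hn
  rw [J, Finset.card_image_of_injOn, Nat.card_Ico]
  · omega
  · have key : ∀ i j : ℕ, i < j → j < k.length → k.sizeUpTo i < k.sizeUpTo j := by
      intro i j hij hj
      exact (k.sizeUpTo_strict_mono (by omega : i < k.length)).trans_le (k.monotone_sizeUpTo hij)
    intro i hi j hj hij
    simp only [Finset.coe_Ico, Set.mem_Ico] at hi hj
    rcases lt_trichotomy i j with h | h | h
    · exact absurd hij (key i j h hj.2).ne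
    · exact h
    · exact absurd hij (key j i h hi.2).ne'

/-- Sums over the indices of weight `n` are sums over the subsets of `{1, …, n - 1}`. -/
theorem sum_composition {n : ℕ} (P : Finset ℕ → Prop) [DecidablePred P] (g : Finset ℕ → ℝ) :
    ∑ k : Composition n with P (J k), g (J k) =
      ∑ B ∈ (Finset.Ico 1 n).powerset with P B, g B := by
  refine Finset.sum_nbij J ?_ ?_ ?_ fun _ _ => rfl
  · intro k hk
    exact Finset.mem_filter.2 ⟨Finset.mem_powerset.2 (J_subset k), (Finset.mem_filter.1 hk).2⟩
  · exact fun k _ k' _ h => eq_of_J_eq h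
  · intro B hB
    obtain ⟨hB1, hB2⟩ := Finset.mem_filter.1 hB
    obtain ⟨k, rfl⟩ := exists_J_eq (Finset.mem_powerset.1 hB1)
    exact ⟨k, by simpa using hB2, rfl⟩

theorem J_ones (l : ℕ) : J (Composition.ones l) = Finset.Ico 1 l := by
  ext m
  simp only [J, Finset.mem_image, Composition.ones_length, Composition.ones_sizeUpTo,
    Finset.mem_Ico]
  constructor
  · rintro ⟨i, hi, rfl⟩
    rwa [min_eq_left hi.2.le]
  · intro h
    exact ⟨m, h, min_eq_left h.2.le⟩

/-! ### Sums over refinements -/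

/-- The sum over refinements is built one position at a time: at a position outside `A` one may
divide by `N`, or sum over `m < N` first, and the two together give the sum over `m ≤ N`. -/
theorem sum_coeff_eq_refineCoeff (A : Finset ℕ) (j N : ℕ) :
    ∑ B ∈ (Finset.Icc 1 j).powerset with A ∩ Finset.Icc 1 j ⊆ B, coeff B j N =
      refineCoeff A j N := by
  induction j generalizing N with
  | zero => simp [coeff, refineCoeff]
  | succ j ih =>
    have hnot : j + 1 ∉ Finset.Icc 1 j := by simp
    have hBn : ∀ B ∈ (Finset.Icc 1 j).powerset, j + 1 ∉ B := fun B hB h =>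
      hnot (Finset.mem_powerset.1 hB h)
    simp only [Finset.sum_filter] at ih ⊢
    rw [← Finset.insert_Icc_right_eq_Icc_add_one (by omega), Finset.sum_powerset_insert hnot]
    have hins : ∀ B : Finset ℕ, coeff (insert (j + 1) B) j = coeff B j := fun B =>
      coeff_congr fun i hi => by
        have : i ≠ j + 1 := by
          have := Finset.mem_Icc.1 hi
          omega
        simp [this]
    have hsecond : ∀ B ∈ (Finset.Icc 1 j).powerset,
        (if A ∩ insert (j + 1) (Finset.Icc 1 j) ⊆ insert (j + 1) B
          then coeff (insert (j + 1) B) (j + 1) N else 0) =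
        (∑ m ∈ Finset.range N, if A ∩ Finset.Icc 1 j ⊆ B then coeff B j m else 0) / N := by
      intro B hB
      have hiff : A ∩ insert (j + 1) (Finset.Icc 1 j) ⊆ insert (j + 1) B ↔
          A ∩ Finset.Icc 1 j ⊆ B := by
        constructor
        · intro h x hx
          have hx' := Finset.mem_inter.1 hx
          have := h (Finset.mem_inter.2 ⟨hx'.1, Finset.mem_insert_of_mem hx'.2⟩)
          exact (Finset.mem_insert.1 this).resolve_left fun e => hnot (e ▸ hx'.2)
        · intro h x hx
          obtain ⟨h1, h2⟩ := Finset.mem_inter.1 hx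
          rcases Finset.mem_insert.1 h2 with rfl | h2
          · exact Finset.mem_insert_self _ _
          · exact Finset.mem_insert_of_mem (h (Finset.mem_inter.2 ⟨h1, h2⟩))
      simp only [hiff]
      split_ifs with h
      · simp only [coeff, Finset.mem_insert_self, if_true, hins]
      · simp
    rw [Finset.sum_congr rfl hsecond, ← Finset.sum_div, Finset.sum_comm,
      Finset.sum_congr rfl fun m _ => ih m]
    by_cases hA : j + 1 ∈ A
    · have hfirst : ∀ B ∈ (Finset.Icc 1 j).powerset,
          (if A ∩ insert (j + 1) (Finset.Icc 1 j) ⊆ B then coeff B (j + 1) N else 0) = 0 := by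
        intro B hB
        refine if_neg fun h => hBn B hB (h ?_)
        simp [hA]
      rw [Finset.sum_eq_zero hfirst, zero_add, refineCoeff, if_pos hA]
    · rw [Finset.inter_insert_of_notMem hA, refineCoeff, if_neg hA, Finset.sum_range_succ, add_div,
        add_comm, ← ih N]
      congr 1
      rw [Finset.sum_div]
      refine Finset.sum_congr rfl fun B hB => ?_
      rw [coeff, if_neg (hBn B hB)]
      split_ifs <;> simp

theorem sum_neg_one_pow_card_superset {S I : Finset ℕ} (h : S ⊆ I) :
    ∑ C ∈ I.powerset with S ⊆ C, (-1 : ℝ) ^ C.card = if I ⊆ S then (-1) ^ I.card else 0 := by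
  have h1 : I.powerset.filter (S ⊆ ·) = Finset.Icc S I := by
    ext C
    simp [and_comm]
  rw [h1, Finset.Icc_eq_image_powerset h, Finset.sum_image]
  · have h2 : ∀ D ∈ (I \ S).powerset, (-1 : ℝ) ^ (S ∪ D).card = (-1) ^ S.card * (-1) ^ D.card := by
      intro D hD
      rw [Finset.card_union_of_disjoint, pow_add]
      exact Finset.disjoint_of_subset_right (Finset.mem_powerset.1 hD) Finset.disjoint_sdiff
    have h3 : ∑ D ∈ (I \ S).powerset, (-1 : ℝ) ^ D.card = if I \ S = ∅ then 1 else 0 := by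
      exact_mod_cast congrArg (Int.cast : ℤ → ℝ) (Finset.sum_powerset_neg_one_pow_card (x := I \ S))
    rw [Finset.sum_congr rfl h2, ← Finset.mul_sum, h3]
    simp only [Finset.sdiff_eq_empty_iff_subset]
    split_ifs with hIS
    · rw [Finset.Subset.antisymm h hIS, mul_one]
    · rw [mul_zero]
  · intro D hD D' hD' e
    have hd : ∀ D ∈ (I \ S).powerset, (S ∪ D) \ S = D := by
      intro D hD
      rw [Finset.union_sdiff_left, Finset.sdiff_eq_self_iff_disjoint]
      exact (Finset.disjoint_of_subset_right (Finset.mem_powerset.1 hD)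
        Finset.disjoint_sdiff).symm
    rw [← hd D hD, ← hd D' hD']
    exact congrArg (· \ S) e

/-- The alternating sum over refinements of the dual of the star sums equals, up to sign, the sum
over refinements. -/
theorem sum_refine_dual {I A : Finset ℕ} (hA : A ⊆ I) (X : Finset ℕ → ℝ) :
    ∑ C ∈ I.powerset with I \ A ⊆ C, (-1 : ℝ) ^ C.card * ∑ B ∈ I.powerset with B ⊆ C, X B =
      (-1) ^ I.card * ∑ B ∈ I.powerset with A ⊆ B, X B := by
  have h1 : ∀ B ∈ I.powerset, ∑ C ∈ I.powerset with I \ A ∪ B ⊆ C, (-1 : ℝ) ^ C.card =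
      if A ⊆ B then (-1) ^ I.card else 0 := by
    intro B hB
    rw [sum_neg_one_pow_card_superset
      (Finset.union_subset Finset.sdiff_subset (Finset.mem_powerset.1 hB))]
    have : I ⊆ I \ A ∪ B ↔ A ⊆ B := by
      constructor
      · intro h x hx
        rcases Finset.mem_union.1 (h (hA hx)) with h | h
        · exact absurd hx (Finset.mem_sdiff.1 h).2
        · exact h
      · intro h x hx
        by_cases hxA : x ∈ A
        · exact Finset.mem_union_right _ (h hxA)
        · exact Finset.mem_union_left _ (Finset.mem_sdiff.2 ⟨hx, hxA⟩)
    simp only [this]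
  simp only [Finset.sum_filter, Finset.mul_sum, Finset.union_subset_iff] at h1 ⊢
  calc ∑ C ∈ I.powerset, (if I \ A ⊆ C then
        ∑ B ∈ I.powerset, (-1 : ℝ) ^ C.card * (if B ⊆ C then X B else 0) else 0)
      = ∑ C ∈ I.powerset, ∑ B ∈ I.powerset,
          X B * (if I \ A ⊆ C ∧ B ⊆ C then (-1 : ℝ) ^ C.card else 0) := by
        refine Finset.sum_congr rfl fun C _ => ?_
        by_cases h : I \ A ⊆ C
        · simp only [h, if_true, true_and]
          refine Finset.sum_congr rfl fun B _ => ?_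
          split_ifs <;> ring
        · simp [h]
    _ = _ := by
        rw [Finset.sum_comm]
        refine Finset.sum_congr rfl fun B hB => ?_
        rw [← Finset.mul_sum, h1 B hB]
        split_ifs <;> ring

end KanekoTsumura

namespace KanekoTsumura

/-! ### Polylogarithms and star sums of indices -/

theorem isPolylog_of_eq_genFun {n : ℕ} (hn : 0 < n) (k : Composition n) {G : ℂ → ℂ}
    (hd : DifferentiableOn ℂ G slitDomain)
    (hG : ∀ z : ℂ, ‖z‖ < 1 → G z = genFun (coeff (J k) (n - 1)) z) : IsPolylog k.blocks G := by
  refine ⟨hd, fun z hz => ?_⟩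
  obtain ⟨C, hC⟩ := (decay_coeff (J k) (n - 1)).bounded
  have h := hasSum_mzvTerm k.blocks (fun N => z ^ N) (by
    rw [nested_blocks hn]
    refine (summable_genFun hC hz).norm.congr fun N => ?_
    have h0 : 0 ≤ coeff (J k) (n - 1) N := by
      rw [← nested_blocks hn]
      exact nested_nonneg _ _
    rw [norm_mul, Complex.norm_real, Real.norm_eq_abs, abs_of_nonneg h0, mul_comm])
  have e1 : polylogTerm k.blocks z = fun m => z ^ lastEntry m.1 * (mzvTerm k.blocks m : ℂ) := by
    funext m
    simp only [polylogTerm, mzvTerm]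
    push_cast
    rw [mul_one_div]
  have e2 : G z = ∑' N, z ^ N * (nested k.blocks.reverse N : ℂ) := by
    rw [hG z hz, nested_blocks hn]
    exact tsum_congr fun N => mul_comm _ _
  rw [e1, e2]
  exact h

theorem IsPolylog.eqOn {k : List ℕ} {F G : ℂ → ℂ} (hF : IsPolylog k F) (hG : IsPolylog k G) :
    Set.EqOn F G slitDomain := by
  refine (hF.1.analyticOnNhd isOpen_slitDomain).eqOn_of_preconnected_of_eventuallyEq
    (hG.1.analyticOnNhd isOpen_slitDomain)
    (starConvex_slitDomain.isPathConnected zero_mem_slitDomain).isConnected.isPreconnected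
    zero_mem_slitDomain ?_
  filter_upwards [Metric.ball_mem_nhds (0 : ℂ) one_pos] with z hz
  have hz' := mem_ball_zero_iff.1 hz
  exact (hF.2 z hz').unique (hG.2 z hz')

theorem isPolylog_polylog {k : List ℕ} {G : ℂ → ℂ} (hG : IsPolylog k G) :
    IsPolylog k (polylog k) :=
  Classical.epsilon_spec ⟨G, hG⟩

theorem blocks_ne_nil {n : ℕ} (hn : 0 < n) (k : Composition n) : k.blocks ≠ [] := by
  intro h
  have := k.blocks_sum
  rw [h, List.sum_nil] at this
  omega

theorem circLin_starSum {n l : ℕ} (k : Composition n) (k' : Composition l) :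
    circLin (starSum k) (starSum k') =
      ∑ i : Composition n with Refines k i, ∑ i' : Composition l with Refines k' i',
        circ i.blocks i'.blocks :=
  circLin_sum _ _ _ _

theorem summable_of_mem_support_circLin {n l : ℕ} (hn : 0 < n) (hl : 0 < l) (k : Composition n)
    (k' : Composition l) {m : List ℕ} (hm : m ∈ (circLin (starSum k) (starSum k')).support) :
    Summable (mzvTerm m) := by
  classical
  rw [circLin_starSum] at hm
  obtain ⟨i, -, hm⟩ := Finset.mem_biUnion.1 (Finsupp.support_finsetSum hm)
  obtain ⟨i', -, hm⟩ := Finset.mem_biUnion.1 (Finsupp.support_finsetSum hm)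
  exact summable_mzvTerm (summable_nested_of_mem_support_circ (blocks_ne_nil hn i)
    (blocks_ne_nil hl i') (fun _ => i.blocks_pos) (fun _ => i'.blocks_pos) hm)

/-- The star sum of `(1, …, 1)` has the coefficients `refineCoeff ∅`, as every index of weight `l`
is refined by `(1, …, 1)`. -/
theorem mzvLin_circLin_starSum_ones {n l : ℕ} (hn : 0 < n) (hl : 0 < l) (k : Composition n) :
    mzvLin (circLin (starSum k) (starSum (Composition.ones l))) =
      ∑ B ∈ (Finset.Ico 1 n).powerset with B ⊆ J k,
        ∑' N, coeff B (n - 1) N * refineCoeff ∅ (l - 1) N := by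
  rw [circLin_starSum, mzvLin_sum, ← sum_composition (fun B => B ⊆ J k)
    (fun B => ∑' N, coeff B (n - 1) N * refineCoeff ∅ (l - 1) N)]
  refine Finset.sum_congr rfl fun i _ => ?_
  have hones : ∀ N, refineCoeff ∅ (l - 1) N =
      ∑ i' : Composition l with Refines (Composition.ones l) i', coeff (J i') (l - 1) N := by
    intro N
    have hI : Finset.Icc 1 (l - 1) = Finset.Ico 1 l := by
      ext x
      simp only [Finset.mem_Icc, Finset.mem_Ico]
      omega
    rw [← sum_coeff_eq_refineCoeff, hI]
    refine Eq.trans ?_ (sum_composition (fun B => B ⊆ J (Composition.ones l))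
      fun B => coeff B (l - 1) N).symm
    refine Finset.sum_congr (Finset.filter_congr fun B hB => ?_) fun _ _ => rfl
    simp [J_ones, Finset.mem_powerset.1 hB]
  simp only [hones, Finset.mul_sum]
  rw [mzvLin_sum, Summable.tsum_finsetSum fun i' _ =>
    (decay_coeff (J i) (n - 1)).summable_mul (decay_coeff (J i') (l - 1))]
  refine Finset.sum_congr rfl fun i' _ => ?_
  rw [mzvLin_circ (blocks_ne_nil hn i) (blocks_ne_nil hl i') (fun _ => i.blocks_pos)
    (fun _ => i'.blocks_pos), nested_blocks hn, nested_blocks hl]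

theorem sum_refines_hoffmanDual {n l : ℕ} (hn : 0 < n) (hl : 0 < l) (k : Composition n) :
    (-1 : ℝ) ^ (hoffmanDual k).length *
        ∑ k' : Composition n with Refines k' (hoffmanDual k), (-1) ^ k'.length *
          mzvLin (circLin (starSum k') (starSum (Composition.ones l))) =
      (-1) ^ (J k).card * ∑' N, refineCoeff (J k) (n - 1) N * refineCoeff ∅ (l - 1) N := by
  set I := Finset.Ico 1 n
  set X : Finset ℕ → ℝ := fun B => ∑' N, coeff B (n - 1) N * refineCoeff ∅ (l - 1) N
  have hA : J k ⊆ I := J_subset k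
  have hI : Finset.Icc 1 (n - 1) = I := by
    ext x
    simp only [I, Finset.mem_Icc, Finset.mem_Ico]
    omega
  have h1 : ∑ k' : Composition n with Refines k' (hoffmanDual k), (-1 : ℝ) ^ k'.length *
      mzvLin (circLin (starSum k') (starSum (Composition.ones l))) =
      -((-1) ^ I.card * ∑ B ∈ I.powerset with J k ⊆ B, X B) := by
    rw [← sum_refine_dual hA, ← Finset.sum_neg_distrib]
    refine Eq.trans ?_ (sum_composition (fun C => I \ J k ⊆ C)
      fun C => -((-1 : ℝ) ^ C.card * ∑ B ∈ I.powerset with B ⊆ C, X B))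
    refine Finset.sum_congr (Finset.filter_congr fun k' _ => ?_) fun k' _ => ?_
    · rw [Refines, J_hoffmanDual]
    · rw [mzvLin_circLin_starSum_ones hn hl, length_eq_card_J hn, pow_succ]
      ring
  have h2 : ∑ B ∈ I.powerset with J k ⊆ B, X B =
      ∑' N, refineCoeff (J k) (n - 1) N * refineCoeff ∅ (l - 1) N := by
    rw [← Summable.tsum_finsetSum fun B _ =>
      (decay_coeff B (n - 1)).summable_mul (decay_refineCoeff ∅ (l - 1))]
    refine tsum_congr fun N => ?_
    rw [← Finset.sum_mul, ← sum_coeff_eq_refineCoeff (J k), hI, Finset.inter_eq_left.2 hA]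
  have h3 : (hoffmanDual k).length = (I.card - (J k).card) + 1 := by
    rw [length_eq_card_J hn, J_hoffmanDual, Finset.card_sdiff_of_subset hA]
  have h4 : ((-1 : ℝ) ^ (I.card - (J k).card)) * (-1) ^ I.card = (-1) ^ (J k).card := by
    obtain ⟨d, hd⟩ := Nat.exists_eq_add_of_le (Finset.card_le_card hA)
    rw [hd, Nat.add_sub_cancel_left, pow_add, mul_left_comm, ← mul_pow]
    simp
  rw [h1, h2, h3, pow_succ, ← h4]
  ring

end KanekoTsumura

open KanekoTsumura in
/-- For a nonempty index `k` (of weight `n > 0`) and an integer `l > 0`, the defining objects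
converge (the multiple polylogarithm continues to `ℂ ∖ [1, ∞)`, the integral for `η(k; l)` and all
multiple zeta values involved converge), and
`η(k; l) = (-1)^{d(k^∨)} ∑_{k' ⪰ k^∨} (-1)^{d(k')} ζ((k')^⋆ ⊛ (1, …, 1)^⋆)`. -/
theorem theoremA1 (n : ℕ) (hn : 0 < n) (k : Composition n) (l : ℕ) (hl : 0 < l) :
    IsPolylog k.blocks (polylog k.blocks) ∧
    MeasureTheory.IntegrableOn (etaIntegrand k.blocks l) (Set.Ioi 0) ∧
    (∀ k' : Composition n, Refines k' (hoffmanDual k) →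
      ∀ m ∈ (circLin (starSum k') (starSum (Composition.ones l))).support, Summable (mzvTerm m)) ∧
    eta k.blocks l =
      (((-1) ^ (hoffmanDual k).length *
        ∑ k' : Composition n with Refines k' (hoffmanDual k),
          (-1) ^ k'.length * mzvLin (circLin (starSum k') (starSum (Composition.ones l))) : ℝ) : ℂ) := by
  obtain ⟨G, hGd, -, hGs, hGL⟩ := exists_continuation (J k) (n - 1)
  have hG := isPolylog_of_eq_genFun hn k hGd hGs
  have hP := isPolylog_polylog hG
  have hcpow : ∀ t : ℝ, (t : ℂ) ^ ((l : ℂ) - 1) = (t : ℂ) ^ (l - 1) := by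
    intro t
    rw [← Nat.cast_one, ← Nat.cast_sub (by omega), Complex.cpow_natCast]
  have hI : Set.EqOn (etaIntegrand k.blocks l)
      (fun t : ℝ => G (1 - Complex.exp t) / (1 - Complex.exp t) * (t : ℂ) ^ (l - 1))
      (Set.Ioi 0) := by
    intro t _
    have hmem := ofReal_mem_slitDomain (x := 1 - Real.exp t) (by linarith [Real.exp_pos t])
    push_cast at hmem
    simp only [etaIntegrand]
    rw [hP.eqOn hG hmem, hcpow]
  obtain ⟨hint, hval⟩ := integral_landen (l := l - 1) hGd hGL
  refine ⟨hP, hint.congr_fun hI.symm measurableSet_Ioi,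
    fun k' _ m hm => summable_of_mem_support_circLin hn hl k' _ hm, ?_⟩
  have hΓ : Complex.Gamma l = ((l - 1).factorial : ℂ) := by
    obtain ⟨l, rfl⟩ : ∃ d, l = d + 1 := ⟨l - 1, by omega⟩
    rw [Nat.add_sub_cancel]
    push_cast
    exact Complex.Gamma_nat_eq_factorial l
  have hcard : J k ∩ Finset.Icc 1 (n - 1) = J k := by
    refine Finset.inter_eq_left.2 fun x hx => ?_
    have := Finset.mem_Ico.1 (J_subset k hx)
    exact Finset.mem_Icc.2 ⟨this.1, by omega⟩
  have hne : ((l - 1).factorial : ℂ) ≠ 0 := Nat.cast_ne_zero.2 (Nat.factorial_ne_zero _)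
  rw [sum_refines_hoffmanDual hn hl, eta, MeasureTheory.setIntegral_congr_fun measurableSet_Ioi hI,
    hval, hΓ, depthSign, hcard, pow_succ]
  push_cast
  field_simp
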